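/- A generalized Pólya urn has $q\ge 2$ types of balls with activities $a=(a_1,\dots,a_q)^T$, $a_i\ge 0$, random replacement vectors $\xi_i=(\xi_{i,1},\dots,\xi_{i,q})^T$ in $\mathbb R^q$, and a deterministic initial composition $X_0\in\mathbb R_{\ge 0}^q$ with $a\cdot X_0>0$. Its composition $(X_n)_{n\ge 0}$ evolves as follows. Put $S_n=a\cdot X_n$. Given $X_0,\dots,X_n$, if $S_n>0$ a ball is drawn, of type $i$ with probability $a_iX_{n,i}/S_n$, and $X_{n+1}=X_n+\Delta X_n$ where $\Delta X_n$ is distributed as $\xi_i$ if type $i$ is drawn, independently of the past; if $S_n=0$, then $X_{n+1}=X_n$. Let $\mathcal E_n^c=\{S_k>0 \text{ for all } 0\le k\le n\}$ be the event of non-extinction up to time $n$, and let $A=(a_j\mathbb E\xi_{j,i})_{i,j=1}^q$ be the intensity matrix, with eigenvalues $\lambda_1,\dots,\lambda_q$ listed with algebraic multiplicity so that $\Re\lambda_1\ge\Re\lambda_2\ge\cdots\ge\Re\lambda_q$. **Theorem.** Assume $U_2$: the urn is tenable (almost surely $X_n\in\mathbb R_{\ge0}^q$ for all $n$); it is balanced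 in expectation, i.e. there is a constant $b>0$ with $\sum_{j} a_j\mathbb E\xi_{i,j}=b$ for every $i$ with $a_i>0$; $\lambda_1=b$; and $\mathbb E|\xi_i|^2<\infty$ for all $i$. Assume that the urn is strictly small, i.e. $\lambda_1>2\Re\lambda_2$, and let $v_1$ be the unique vector with $Av_1=\lambda_1v_1$ and $a\cdot v_1=1$. Suppose that, for some covariance matrix $\Sigma$, conditioned on non-extinction, $$\frac{X_n-n\lambda_1v_1}{\sqrt n}\xrightarrow{d}\mathcal N(0,\Sigma)\qquad(n\to\infty).$$ Here the law of the $n$-th term may be conditioned either on $\mathcal E_n^c$ or on $\bigcap_{k}\mathcal E_k^c$; it is enough that the convergence holds for one of the two. Then $\mathbb P\left(\bigcap_k\mathcal E_k^c\right)>0$, each $X_n$ is integrable conditioned on $\mathcal E_n^c$, $$\mathbb E[X_n\mid\mathcal E_n^c]=n\lambda_1v_1+o(\sqrt n),$$ and, conditioned on non-extinction (in either of the two senses), $$\frac{X_n-\mathbb E[X_n\mid\mathcal E_n^c]}{\sqrt n}\xrightarrow{d}\mathcal N(0,\Sigma).$$ -/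

import Mathlib

open MeasureTheory ProbabilityTheory Filter Topology Matrix Asymptotics
open scoped ENNReal BoundedContinuousFunction

noncomputable section

/-- The data of a generalized Pólya urn with `q` types of balls: the activities `a_i ≥ 0`, the laws
of the replacement vectors `ξ_i`, and a deterministic non-negative initial composition of positive
total activity. -/
structure PolyaUrn (q : ℕ) where
  /-- the activity vector `a` -/
  activity : Fin q → ℝ
  activity_nonneg : ∀ i, 0 ≤ activity i
  /-- the law of the replacement vector `ξ_i` -/
  replacement : Fin q → Measure (EuclideanSpace ℝ (Fin q))
  replacement_prob : ∀ i, IsProbabilityMeasure (replacement i)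
  /-- the initial composition `X_0` -/
  initial : EuclideanSpace ℝ (Fin q)
  initial_nonneg : ∀ i, 0 ≤ initial i
  initial_activity_pos : 0 < ∑ i, activity i * initial i

namespace PolyaUrn

variable {q : ℕ} (U : PolyaUrn q)

/-- The total activity `a · x` of an urn with composition `x`. -/
def totalActivity (x : EuclideanSpace ℝ (Fin q)) : ℝ := ∑ i, U.activity i * x i

open Classical in
/-- The law of the increment of an urn whose current composition is `x`: if the total activity is
positive, a ball of type `i` is drawn with probability `a_i x_i / (a · x)`, and the increment is then
distributed as `ξ_i`; otherwise no ball is drawn and the increment is zero. -/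
def stepLaw (x : EuclideanSpace ℝ (Fin q)) : Measure (EuclideanSpace ℝ (Fin q)) :=
  if 0 < U.totalActivity x then
    ∑ i, ENNReal.ofReal (U.activity i * x i / U.totalActivity x) • U.replacement i
  else Measure.dirac 0

/-- The intensity matrix `A`, with entries `A i j = a_j E[ξ_{j,i}]`. -/
def intensity : Matrix (Fin q) (Fin q) ℝ :=
  Matrix.of fun i j => U.activity j * ∫ x, x i ∂(U.replacement j)

/-- The complex eigenvalues of the intensity matrix, with algebraic multiplicity. -/
def eigenvalues : Multiset ℂ := (U.intensity.map (algebraMap ℝ ℂ)).charpoly.roots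

/-- The urn is balanced in expectation, with constant `b > 0`: if `a_i > 0` then
`∑ j, a_j E[ξ_{i,j}] = b`. -/
def BalancedInExpectation (b : ℝ) : Prop :=
  0 < b ∧ ∀ i, 0 < U.activity i → ∑ j, U.activity j * ∫ x, x j ∂(U.replacement i) = b

/-- `b` is the eigenvalue `λ₁`: an eigenvalue of largest real part. -/
def IsLeadingEigenvalue (b : ℝ) : Prop :=
  (b : ℂ) ∈ U.eigenvalues ∧ ∀ z ∈ U.eigenvalues, z.re ≤ b

/-- With `b = λ₁`, the urn is strictly small: every other eigenvalue `z` (counted with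
multiplicity, so one copy of `b` is removed) satisfies `2 Re z < b`. -/
def StrictlySmall (b : ℝ) : Prop :=
  ∀ z ∈ U.eigenvalues.erase (b : ℂ), 2 * z.re < b

variable {Ω : Type*} [MeasurableSpace Ω] (μ : Measure Ω) (X : ℕ → Ω → EuclideanSpace ℝ (Fin q))

/-- The σ-algebra generated by `X_0, …, X_n`. -/
@[reducible] def history (X : ℕ → Ω → EuclideanSpace ℝ (Fin q)) (n : ℕ) : MeasurableSpace Ω :=
  ⨆ k ∈ Set.Iic n, MeasurableSpace.comap (X k) inferInstance

/-- `X` is the composition process of the urn: it starts at the initial composition, and given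
`X_0, …, X_n` the increment `X_{n+1} - X_n` has law `stepLaw X_n`. -/
structure IsUrnEvolution : Prop where
  measurable : ∀ n, Measurable (X n)
  initial : ∀ᵐ ω ∂μ, X 0 ω = U.initial
  step : ∀ (n : ℕ) (H : Set Ω) (B : Set (EuclideanSpace ℝ (Fin q))),
    MeasurableSet[history X n] H → MeasurableSet B →
      μ (H ∩ {ω | X (n + 1) ω - X n ω ∈ B}) = ∫⁻ ω in H, U.stepLaw (X n ω) B ∂μ

/-- Tenability: almost surely, the composition of the urn is non-negative at each step. -/
def Tenable (μ : Measure Ω) (X : ℕ → Ω → EuclideanSpace ℝ (Fin q)) : Prop :=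
  ∀ n, ∀ᵐ ω ∂μ, ∀ i, 0 ≤ X n ω i

/-- The assumption `U_p`: the urn is tenable and balanced in expectation, `λ₁ = b > 0`, and every
replacement vector has a finite `p`-th moment. -/
structure AssumptionU (b : ℝ) (p : ℝ≥0∞) : Prop where
  tenable : Tenable μ X
  balanced : U.BalancedInExpectation b
  leading : U.IsLeadingEigenvalue b
  moment : ∀ i, MemLp id p (U.replacement i)

/-- The event of non-extinction up to time `n`: `S_k > 0` for all `0 ≤ k ≤ n`. -/
def nonExtinctUpTo (n : ℕ) : Set Ω := {ω | ∀ k ≤ n, 0 < U.totalActivity (X k ω)}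

/-- The event of non-extinction: `S_k > 0` for all `k`. -/
def nonExtinct : Set Ω := {ω | ∀ k, 0 < U.totalActivity (X k ω)}

/-- The conditional expectation `E[X_n | E_n^c]` given the event of non-extinction up to time `n`. -/
def condMean (n : ℕ) : EuclideanSpace ℝ (Fin q) :=
  ∫ ω, X n ω ∂(ProbabilityTheory.cond μ (U.nonExtinctUpTo X n))

/-- The laws of `Y_n` under the conditional probabilities `μ(· | C_n)` converge weakly to the
centred normal distribution with covariance matrix `S`. -/
def TendstoGaussianGiven (μ : Measure Ω) (C : ℕ → Set Ω)
    (Y : ℕ → Ω → EuclideanSpace ℝ (Fin q)) (S : Matrix (Fin q) (Fin q) ℝ) : Prop :=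
  ∀ f : EuclideanSpace ℝ (Fin q) →ᵇ ℝ,
    Tendsto (fun n => ∫ ω, f (Y n ω) ∂(ProbabilityTheory.cond μ (C n))) atTop
      (𝓝 (∫ y, f y ∂(multivariateGaussian 0 S)))

/-- The normal limit law for `(X_n - c_n) / √n` with covariance matrix `S`, conditioned on the
events `C_n`. -/
def NormalLimit (C : ℕ → Set Ω) (c : ℕ → EuclideanSpace ℝ (Fin q))
    (S : Matrix (Fin q) (Fin q) ℝ) : Prop :=
  TendstoGaussianGiven μ C (fun n ω => (Real.sqrt n)⁻¹ • (X n ω - c n)) S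

end PolyaUrn

end

/-! ### One-step law of the urn and square integrability of the composition. -/

namespace PolyaUrn

variable {q : ℕ} (U : PolyaUrn q)

/-! Convergence in law is given; the point is that the conditional means follow it. They do once the
normalised compositions are bounded in L²: truncation at height R then costs O(1/R) uniformly in n,
so the means tend to the mean 0 of the Gaussian (`tendsto_integral_of_tendsto_of_sq_le`). This is
the o(√n) claim, and recentring by a vanishing shift keeps the limit law.

The L² bound is `exists_integral_norm_sub_sq_le`. Let E_n be non-extinction up to time n and T the
transpose of A acting on complex covectors. From x the mean increment is Ax/(a·x), while a·X_n − nb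
is a martingale up to extinction with variance O(n). So a·X_n is close to nb, and if Tu = zu the
second moment w_n of u·X_n obeys roughly w_{n+1} ≤ (1 + 2 Re z/(bn)) w_n + O(1), whence w_n = O(n)
when 2 Re z < b. Jordan blocks are handled by removing factors T − z one at a time. By
Cayley–Hamilton and the simplicity of b, each covector killing v₁ is annihilated by the product of T
− z over the other eigenvalues; together with a, these covectors recover every coordinate.

Conditioning costs only a constant since survival has positive probability
(`measure_nonExtinct_pos`): a bounded function of the activity that vanishes at extinction is a
submartingale. For the same reason the two senses of conditioning give the same limits. -/

instance (i : Fin q) : IsProbabilityMeasure (U.replacement i) := U.replacement_prob i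

lemma measurable_totalActivity : Measurable U.totalActivity := by
  unfold totalActivity; fun_prop

/-- The compositions from which the urn can make a draw. -/
def live : Set (EuclideanSpace ℝ (Fin q)) := {x | (∀ i, 0 ≤ x i) ∧ 0 < U.totalActivity x}

/-- The probability that a ball of type `i` is drawn. -/
noncomputable def drawProb (x : EuclideanSpace ℝ (Fin q)) (i : Fin q) : ℝ :=
  U.activity i * x i / U.totalActivity x

lemma measurable_drawProb (i : Fin q) : Measurable fun x => U.drawProb x i := by
  have := U.measurable_totalActivity
  unfold drawProb; fun_prop

variable {U} in
lemma drawProb_nonneg {x : EuclideanSpace ℝ (Fin q)} (hx : x ∈ U.live) (i : Fin q) :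
    0 ≤ U.drawProb x i :=
  div_nonneg (mul_nonneg (U.activity_nonneg i) (hx.1 i)) hx.2.le

variable {U} in
lemma sum_drawProb {x : EuclideanSpace ℝ (Fin q)} (hx : x ∈ U.live) :
    ∑ i, U.drawProb x i = 1 := by
  unfold drawProb
  rw [← Finset.sum_div]
  exact div_self hx.2.ne'

variable {U} in
lemma drawProb_le_one {x : EuclideanSpace ℝ (Fin q)} (hx : x ∈ U.live) (i : Fin q) :
    U.drawProb x i ≤ 1 := by
  rw [← sum_drawProb hx]
  exact Finset.single_le_sum (fun j _ => drawProb_nonneg hx j) (Finset.mem_univ i)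

lemma measurableSet_live : MeasurableSet U.live := by
  have h1 : MeasurableSet {x : EuclideanSpace ℝ (Fin q) | ∀ i, 0 ≤ x i} := by
    rw [Set.ofPred_forall]
    exact MeasurableSet.iInter fun i => measurableSet_le measurable_const (by fun_prop)
  exact h1.inter (measurableSet_lt measurable_const U.measurable_totalActivity)

variable {U} in
lemma stepLaw_of_mem_live {x : EuclideanSpace ℝ (Fin q)} (hx : x ∈ U.live) :
    U.stepLaw x = ∑ i, ENNReal.ofReal (U.drawProb x i) • U.replacement i := by
  unfold stepLaw drawProb
  rw [if_pos hx.2]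

open Classical in
/-- The law of the increment as a kernel, trivial outside of the set of live compositions. -/
noncomputable def stepKernel : Kernel (EuclideanSpace ℝ (Fin q)) (EuclideanSpace ℝ (Fin q)) where
  -- Off the nonnegative orthant the weights in `stepLaw` are truncated by `ENNReal.ofReal` and need
  -- not sum to one; the Dirac mass keeps the kernel Markov.
  toFun x := if x ∈ U.live then ∑ i, ENNReal.ofReal (U.drawProb x i) • U.replacement i
    else Measure.dirac 0
  measurable' := by
    refine Measurable.ite U.measurableSet_live ?_ measurable_const
    refine Measure.measurable_of_measurable_coe _ fun s _ => ?_
    simp only [Measure.finsetSum_apply, Measure.smul_apply, smul_eq_mul]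
    exact Finset.measurable_fun_sum _ fun i _ =>
      ((U.measurable_drawProb i).ennreal_ofReal).mul measurable_const

variable {U} in
lemma stepKernel_of_mem_live {x : EuclideanSpace ℝ (Fin q)} (hx : x ∈ U.live) :
    U.stepKernel x = ∑ i, ENNReal.ofReal (U.drawProb x i) • U.replacement i :=
  if_pos hx

instance : IsMarkovKernel U.stepKernel := by
  refine ⟨fun x => ⟨?_⟩⟩
  by_cases hx : x ∈ U.live
  · rw [stepKernel_of_mem_live hx]
    simp only [Measure.finsetSum_apply, Measure.smul_apply, smul_eq_mul, measure_univ, mul_one]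
    rw [← ENNReal.ofReal_sum_of_nonneg fun i _ => drawProb_nonneg hx i, sum_drawProb hx,
      ENNReal.ofReal_one]
  · have : U.stepKernel x = Measure.dirac 0 := if_neg hx
    rw [this]; simp

variable {Ω : Type*} {X : ℕ → Ω → EuclideanSpace ℝ (Fin q)}

lemma measurableSet_history_preimage {k n : ℕ} (hk : k ≤ n)
    {s : Set (EuclideanSpace ℝ (Fin q))} (hs : MeasurableSet s) :
    MeasurableSet[history X n] (X k ⁻¹' s) :=
  (le_iSup₂_of_le (f := fun k (_ : k ∈ Set.Iic n) => MeasurableSpace.comap (X k) inferInstance)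
    k hk le_rfl : MeasurableSpace.comap (X k) inferInstance ≤ history X n) _ ⟨s, hs, rfl⟩

lemma measurableSet_history_nonExtinctUpTo (n : ℕ) :
    MeasurableSet[history X n] (U.nonExtinctUpTo X n) := by
  have : U.nonExtinctUpTo X n
      = ⋂ k, ⋂ (_ : k ≤ n), X k ⁻¹' (U.totalActivity ⁻¹' Set.Ioi 0) := by
    ext ω; simp [nonExtinctUpTo]
  rw [this]
  exact MeasurableSet.iInter fun k => MeasurableSet.iInter fun hk =>
    measurableSet_history_preimage hk (U.measurable_totalActivity measurableSet_Ioi)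

variable {U} in
lemma nonExtinctUpTo_antitone : Antitone (U.nonExtinctUpTo X) :=
  fun _ _ hmn _ h k hk => h k (hk.trans hmn)

variable {U} in
lemma iInter_nonExtinctUpTo : ⋂ n, U.nonExtinctUpTo X n = U.nonExtinct X := by
  ext ω
  simp only [Set.mem_iInter]
  exact ⟨fun h k => h k k le_rfl, fun h n k _ => h k⟩

variable {U} in
lemma nonExtinct_subset_nonExtinctUpTo (n : ℕ) : U.nonExtinct X ⊆ U.nonExtinctUpTo X n :=
  fun _ h k _ => h k

variable [MeasurableSpace Ω] {μ : Measure Ω}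

lemma history_le (hX : ∀ n, Measurable (X n)) (n : ℕ) : history X n ≤ ‹MeasurableSpace Ω› :=
  iSup₂_le fun k _ => (hX k).comap_le

variable {U}

lemma measurableSet_nonExtinctUpTo (hX : ∀ n, Measurable (X n)) (n : ℕ) :
    MeasurableSet (U.nonExtinctUpTo X n) :=
  history_le hX n _ (U.measurableSet_history_nonExtinctUpTo n)

lemma ae_mem_live (hX : U.IsUrnEvolution μ X) (hT : Tenable μ X) (n : ℕ) :
    ∀ᵐ ω ∂(μ.restrict (U.nonExtinctUpTo X n)), X n ω ∈ U.live := by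
  filter_upwards [ae_restrict_mem (measurableSet_nonExtinctUpTo hX.measurable n),
    ae_restrict_of_ae (hT n)] with ω h1 h2
  exact ⟨h2, h1 n le_rfl⟩

/-- Checked on rectangles s × t by testing the evolution on {X_n ∈ s} ∩ E_n, an event of the history
on which X_n is almost surely live. Expectations of functions of the composition and its increment
then reduce to Fubini. -/
lemma map_prod_increment [IsFiniteMeasure μ] (hX : U.IsUrnEvolution μ X) (hT : Tenable μ X)
    (n : ℕ) :
    (μ.restrict (U.nonExtinctUpTo X n)).map (fun ω => (X n ω, X (n + 1) ω - X n ω))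
      = ((μ.restrict (U.nonExtinctUpTo X n)).map (X n)) ⊗ₘ U.stepKernel := by
  have hm := hX.measurable
  have hE := measurableSet_nonExtinctUpTo (U := U) hm n
  have hpair : Measurable fun ω => (X n ω, X (n + 1) ω - X n ω) :=
    (hm n).prodMk ((hm (n + 1)).sub (hm n))
  refine Measure.ext_prod fun {s t} hs ht => ?_
  rw [Measure.map_apply hpair (hs.prod ht), Measure.restrict_apply (hpair (hs.prod ht)),
    Measure.compProd_apply_prod hs ht,
    setLIntegral_map hs (U.stepKernel.measurable_coe ht) (hm n),
    Measure.restrict_restrict (hm n hs)]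
  have hset : (fun ω => (X n ω, X (n + 1) ω - X n ω)) ⁻¹' s ×ˢ t ∩ U.nonExtinctUpTo X n
      = (X n ⁻¹' s ∩ U.nonExtinctUpTo X n) ∩ {ω | X (n + 1) ω - X n ω ∈ t} := by
    ext ω; simp only [Set.mem_inter_iff, Set.mem_preimage, Set.mem_prod, Set.mem_ofPred_eq]; tauto
  have hH : MeasurableSet[history X n] (X n ⁻¹' s ∩ U.nonExtinctUpTo X n) :=
    MeasurableSet.inter (measurableSet_history_preimage le_rfl hs)
      (U.measurableSet_history_nonExtinctUpTo n)
  rw [hset, hX.step n _ t hH ht]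
  refine lintegral_congr_ae ?_
  filter_upwards [ae_restrict_of_ae_restrict_of_subset Set.inter_subset_right
    (ae_mem_live hX hT n)] with ω hω
  rw [stepLaw_of_mem_live hω, stepKernel_of_mem_live hω]

/-- The one-step formula: the conditional expectation of a function of the composition and its
increment. -/
lemma integral_increment [IsFiniteMeasure μ] (hX : U.IsUrnEvolution μ X) (hT : Tenable μ X)
    (n : ℕ) {g : EuclideanSpace ℝ (Fin q) × EuclideanSpace ℝ (Fin q) → ℝ} (hg : Measurable g)
    (hint : ∀ x i, Integrable (fun y => g (x, y)) (U.replacement i))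
    (hgi : Integrable (fun ω => g (X n ω, X (n + 1) ω - X n ω))
      (μ.restrict (U.nonExtinctUpTo X n))) :
    Integrable (fun ω => ∑ i, U.drawProb (X n ω) i * ∫ y, g (X n ω, y) ∂(U.replacement i))
      (μ.restrict (U.nonExtinctUpTo X n)) ∧
    ∫ ω in U.nonExtinctUpTo X n, g (X n ω, X (n + 1) ω - X n ω) ∂μ
      = ∫ ω in U.nonExtinctUpTo X n,
          ∑ i, U.drawProb (X n ω) i * ∫ y, g (X n ω, y) ∂(U.replacement i) ∂μ := by
  have hm := hX.measurable
  have hpair : Measurable fun ω => (X n ω, X (n + 1) ω - X n ω) :=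
    (hm n).prodMk ((hm (n + 1)).sub (hm n))
  have hκ : ∀ x ∈ U.live, ∫ y, g (x, y) ∂(U.stepKernel x)
      = ∑ i, U.drawProb x i * ∫ y, g (x, y) ∂(U.replacement i) := by
    intro x hx
    rw [stepKernel_of_mem_live hx, integral_finsetSum_measure
      fun i _ => (hint x i).smul_measure ENNReal.ofReal_ne_top]
    refine Finset.sum_congr rfl fun i _ => ?_
    rw [integral_smul_measure, ENNReal.toReal_ofReal (drawProb_nonneg hx i), smul_eq_mul]
  have hgc : Integrable g
      (((μ.restrict (U.nonExtinctUpTo X n)).map (X n)) ⊗ₘ U.stepKernel) := by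
    rw [← map_prod_increment hX hT n,
      integrable_map_measure hg.aestronglyMeasurable hpair.aemeasurable]
    exact hgi
  have hκi : Integrable (fun x => ∫ y, g (x, y) ∂(U.stepKernel x))
      ((μ.restrict (U.nonExtinctUpTo X n)).map (X n)) := by
    refine ((Measure.integrable_compProd_iff hgc.aestronglyMeasurable).1 hgc).2.mono'
      (hg.stronglyMeasurable.integral_kernel_prod_right').aestronglyMeasurable
      (Eventually.of_forall fun x => norm_integral_le_integral_norm _)
  have hae : (fun ω => ∫ y, g (X n ω, y) ∂(U.stepKernel (X n ω)))
      =ᵐ[μ.restrict (U.nonExtinctUpTo X n)]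
        fun ω => ∑ i, U.drawProb (X n ω) i * ∫ y, g (X n ω, y) ∂(U.replacement i) :=
    (ae_mem_live hX hT n).mono fun ω hω => hκ _ hω
  constructor
  · exact (hκi.comp_measurable (hm n)).congr hae
  · calc _ = ∫ z, g z ∂((μ.restrict (U.nonExtinctUpTo X n)).map
          (fun ω => (X n ω, X (n + 1) ω - X n ω))) :=
        (integral_map hpair.aemeasurable hg.aestronglyMeasurable).symm
      _ = ∫ ω in U.nonExtinctUpTo X n, ∫ y, g (X n ω, y) ∂(U.stepKernel (X n ω)) ∂μ := by
        rw [map_prod_increment hX hT n, Measure.integral_compProd hgc,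
          integral_map (hm n).aemeasurable]
        exact hκi.aestronglyMeasurable
      _ = _ := integral_congr_ae hae

/-- Draw probabilities are at most one, so the mixture is dominated by the sum of the replacement
laws. This passes moments of the ξ_i to the increments. -/
lemma map_increment_le [IsFiniteMeasure μ] (hX : U.IsUrnEvolution μ X) (hT : Tenable μ X)
    (n : ℕ) :
    (μ.restrict (U.nonExtinctUpTo X n)).map (fun ω => X (n + 1) ω - X n ω)
      ≤ μ Set.univ • ∑ i, U.replacement i := by
  have hm := hX.measurable
  refine Measure.le_iff.2 fun s hs => ?_
  have hd : Measurable fun ω => X (n + 1) ω - X n ω := (hm (n + 1)).sub (hm n)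
  rw [Measure.map_apply hd hs, Measure.restrict_apply (hd hs), Set.inter_comm]
  have := hX.step n _ s (U.measurableSet_history_nonExtinctUpTo n) hs
  change μ (U.nonExtinctUpTo X n ∩ {ω | X (n + 1) ω - X n ω ∈ s}) ≤ _
  rw [this]
  calc _ ≤ ∫⁻ ω in U.nonExtinctUpTo X n, (∑ i, U.replacement i) s ∂μ := by
        refine lintegral_mono_ae ((ae_mem_live hX hT n).mono fun ω hω => ?_)
        rw [stepLaw_of_mem_live hω]
        simp only [Measure.finsetSum_apply, Measure.smul_apply, smul_eq_mul]
        refine Finset.sum_le_sum fun i _ => ?_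
        exact mul_le_of_le_one_left' (ENNReal.ofReal_le_one.2 (drawProb_le_one hω i))
    _ ≤ _ := by
        rw [setLIntegral_const, Measure.smul_apply, smul_eq_mul, mul_comm]
        gcongr
        exact Set.subset_univ _

lemma memLp_increment [IsFiniteMeasure μ] (hX : U.IsUrnEvolution μ X) (hT : Tenable μ X)
    (h2 : ∀ i, MemLp id 2 (U.replacement i)) (n : ℕ) :
    MemLp (fun ω => X (n + 1) ω - X n ω) 2 (μ.restrict (U.nonExtinctUpTo X n)) := by
  have hm := hX.measurable
  have hd : Measurable fun ω => X (n + 1) ω - X n ω := (hm (n + 1)).sub (hm n)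
  have h : MemLp (id : EuclideanSpace ℝ (Fin q) → _) 2 (∑ i, U.replacement i) := by
    rw [memLp_two_iff_integrable_sq_norm measurable_id.aestronglyMeasurable]
    refine integrable_finsetSum_measure.2 fun i _ => ?_
    exact (memLp_two_iff_integrable_sq_norm measurable_id.aestronglyMeasurable).1 (h2 i)
  exact ((h.smul_measure (measure_ne_top μ _)).mono_measure
    (map_increment_le hX hT n)).comp_of_map hd.aemeasurable

lemma memLp_composition [IsFiniteMeasure μ] (hX : U.IsUrnEvolution μ X) (hT : Tenable μ X)
    (h2 : ∀ i, MemLp id 2 (U.replacement i)) (n : ℕ) :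
    MemLp (X n) 2 (μ.restrict (U.nonExtinctUpTo X n)) := by
  induction n with
  | zero =>
    have h : (fun _ => U.initial) =ᵐ[μ.restrict (U.nonExtinctUpTo X 0)] X 0 :=
      (ae_restrict_of_ae hX.initial).mono fun ω h => h.symm
    exact (memLp_const U.initial).ae_eq h
  | succ n ih =>
    have h := ih.add (memLp_increment hX hT h2 n)
    have h' : X n + (fun ω => X (n + 1) ω - X n ω) = X (n + 1) := by ext; simp
    rw [h'] at h
    exact h.mono_measure (Measure.restrict_mono (nonExtinctUpTo_antitone n.le_succ) le_rfl)

/-- The event is E_n, not E_{n+1}: the one-step formula integrates functions of X_{n+1} over E_n. -/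
lemma memLp_composition_succ [IsFiniteMeasure μ] (hX : U.IsUrnEvolution μ X) (hT : Tenable μ X)
    (h2 : ∀ i, MemLp id 2 (U.replacement i)) (n : ℕ) :
    MemLp (X (n + 1)) 2 (μ.restrict (U.nonExtinctUpTo X n)) := by
  have h := (memLp_composition hX hT h2 n).add (memLp_increment hX hT h2 n)
  have h' : X n + (fun ω => X (n + 1) ω - X n ω) = X (n + 1) := by ext; simp
  rwa [h'] at h

end PolyaUrn

/-! ### Second-moment recursion for linear functionals of the composition. -/

namespace PolyaUrn

variable {q : ℕ} (U : PolyaUrn q)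

/-- The mean of the replacement vector `ξ_i`. -/
noncomputable def meanReplacement (i : Fin q) : EuclideanSpace ℝ (Fin q) :=
  ∫ y, y ∂(U.replacement i)

/-- The mean increment of an urn with composition `x`. -/
noncomputable def drift (x : EuclideanSpace ℝ (Fin q)) : EuclideanSpace ℝ (Fin q) :=
  ∑ i, U.drawProb x i • U.meanReplacement i

lemma measurable_drift : Measurable U.drift := by
  have := U.measurable_drawProb
  unfold drift; fun_prop

variable {U}

lemma norm_drift_le {x : EuclideanSpace ℝ (Fin q)} (hx : x ∈ U.live) :
    ‖U.drift x‖ ≤ ∑ i, ‖U.meanReplacement i‖ := by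
  refine (norm_sum_le _ _).trans (Finset.sum_le_sum fun i _ => ?_)
  rw [norm_smul, Real.norm_of_nonneg (drawProb_nonneg hx i)]
  exact mul_le_of_le_one_left (norm_nonneg _) (drawProb_le_one hx i)

variable {Ω : Type*} [MeasurableSpace Ω] {μ : Measure Ω} {X : ℕ → Ω → EuclideanSpace ℝ (Fin q)}
variable {F : Type*} [NormedAddCommGroup F] [InnerProductSpace ℝ F]

/-- The cross term of the square is affine in y, so averaging over the drawn type turns it into an
inner product with the drift. In the recursion, c is the current centre and d its increment. -/
lemma sum_drawProb_mul_integral_sq [CompleteSpace F] (h2 : ∀ i, MemLp id 2 (U.replacement i))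
    (L : EuclideanSpace ℝ (Fin q) →L[ℝ] F) (c d : F) {x : EuclideanSpace ℝ (Fin q)}
    (hx : x ∈ U.live) :
    ∑ i, U.drawProb x i * ∫ y, ‖(L x - c) + (L y - d)‖ ^ 2 ∂(U.replacement i)
      = ‖L x - c‖ ^ 2 + 2 * inner ℝ (L x - c) (L (U.drift x) - d)
        + ∑ i, U.drawProb x i * ∫ y, ‖L y - d‖ ^ 2 ∂(U.replacement i) := by
  have hL2 : ∀ i, MemLp (fun y => L y - d) 2 (U.replacement i) := fun i =>
    (L.comp_memLp' (h2 i)).sub (memLp_const d)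
  have hL1 : ∀ i, Integrable (fun y => L y - d) (U.replacement i) := fun i =>
    (hL2 i).integrable one_le_two
  have hi : ∀ i, ∫ y, ‖(L x - c) + (L y - d)‖ ^ 2 ∂(U.replacement i)
      = ‖L x - c‖ ^ 2 + 2 * inner ℝ (L x - c) (L (U.meanReplacement i) - d)
        + ∫ y, ‖L y - d‖ ^ 2 ∂(U.replacement i) := by
    intro i
    have hid : Integrable (fun y => y) (U.replacement i) := (h2 i).integrable one_le_two
    have h3 : ∫ y, (L y - d) ∂(U.replacement i) = L (U.meanReplacement i) - d := by
      rw [integral_sub (L.integrable_comp hid) (integrable_const d), L.integral_comp_comm hid]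
      simp [meanReplacement]
    have hsq : Integrable (fun y => ‖L y - d‖ ^ 2) (U.replacement i) := (hL2 i).integrable_norm_pow
      (by norm_num)
    have hin : Integrable (fun y => 2 * inner ℝ (L x - c) (L y - d)) (U.replacement i) :=
      ((hL1 i).const_inner (𝕜 := ℝ) (L x - c)).const_mul 2
    have hcin : Integrable (fun y => ‖L x - c‖ ^ 2 + 2 * inner ℝ (L x - c) (L y - d))
      (U.replacement i) := (integrable_const _).add hin
    simp_rw [norm_add_sq_real]
    rw [integral_add hcin hsq, integral_add (integrable_const _) hin,
      integral_const_mul, integral_inner (hL1 i), h3]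
    simp
  simp_rw [hi, mul_add, Finset.sum_add_distrib]
  rw [← Finset.sum_mul, sum_drawProb hx, one_mul]
  congr 2
  have hd : L (U.drift x) - d = ∑ i, U.drawProb x i • (L (U.meanReplacement i) - d) := by
    simp_rw [smul_sub, Finset.sum_sub_distrib, ← Finset.sum_smul, sum_drawProb hx, one_smul, drift,
      map_sum, map_smul]
  rw [hd, inner_sum, Finset.mul_sum]
  refine Finset.sum_congr rfl fun i _ => ?_
  rw [real_inner_smul_right]
  ring

lemma integrable_inner_drift [IsFiniteMeasure μ] (hX : U.IsUrnEvolution μ X) (hT : Tenable μ X)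
    (h2 : ∀ i, MemLp id 2 (U.replacement i)) (L : EuclideanSpace ℝ (Fin q) →L[ℝ] F) (c d : F)
    (n : ℕ) :
    Integrable (fun ω => inner ℝ (L (X n ω) - c) (L (U.drift (X n ω)) - d))
      (μ.restrict (U.nonExtinctUpTo X n)) := by
  have h1 : Integrable (fun ω => L (X n ω) - c) (μ.restrict (U.nonExtinctUpTo X n)) :=
    (L.integrable_comp ((memLp_composition hX hT h2 n).integrable one_le_two)).sub
      (integrable_const c)
  have hdm : AEStronglyMeasurable (fun ω => L (U.drift (X n ω)) - d)
      (μ.restrict (U.nonExtinctUpTo X n)) :=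
    (L.continuous.comp_aestronglyMeasurable
      (U.measurable_drift.comp (hX.measurable n)).aestronglyMeasurable).sub
      aestronglyMeasurable_const
  refine (h1.norm.mul_const (‖L‖ * ∑ i, ‖U.meanReplacement i‖ + ‖d‖)).mono'
    (h1.aestronglyMeasurable.inner hdm) ?_
  filter_upwards [ae_mem_live hX hT n] with ω hω
  refine (norm_inner_le_norm _ _).trans (mul_le_mul_of_nonneg_left ?_ (norm_nonneg _))
  refine (norm_sub_le _ _).trans (add_le_add_left ?_ _)
  exact (L.le_opNorm _).trans
    (mul_le_mul_of_nonneg_left (norm_drift_le hω) (norm_nonneg _))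

/-- Two losses make this an inequality: E_{n+1} is enlarged to E_n, and the draw probabilities in
the noise term are bounded by one. The noise is then a constant, so growth is governed by the drift
term. -/
lemma integral_norm_sq_succ_le [CompleteSpace F] [IsProbabilityMeasure μ] (hX : U.IsUrnEvolution μ X)
    (hT : Tenable μ X) (h2 : ∀ i, MemLp id 2 (U.replacement i))
    (L : EuclideanSpace ℝ (Fin q) →L[ℝ] F) (c d : F) (n : ℕ) :
    ∫ ω in U.nonExtinctUpTo X (n + 1), ‖L (X (n + 1) ω) - (c + d)‖ ^ 2 ∂μ
      ≤ ∫ ω in U.nonExtinctUpTo X n, ‖L (X n ω) - c‖ ^ 2 ∂μ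
        + 2 * ∫ ω in U.nonExtinctUpTo X n,
            inner ℝ (L (X n ω) - c) (L (U.drift (X n ω)) - d) ∂μ
        + ∑ i, ∫ y, ‖L y - d‖ ^ 2 ∂(U.replacement i) := by
  have hsq1 : Integrable (fun ω => ‖L (X (n + 1) ω) - (c + d)‖ ^ 2)
      (μ.restrict (U.nonExtinctUpTo X n)) :=
    ((L.comp_memLp' (memLp_composition_succ hX hT h2 n)).sub (memLp_const (c + d))
      ).integrable_norm_pow (by norm_num)
  have hsq0 : Integrable (fun ω => ‖L (X n ω) - c‖ ^ 2) (μ.restrict (U.nonExtinctUpTo X n)) :=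
    ((L.comp_memLp' (memLp_composition hX hT h2 n)).sub (memLp_const c)
      ).integrable_norm_pow (by norm_num)
  have hin := integrable_inner_drift hX hT h2 L c d n
  have hgeq : ∀ ω, ‖L (X (n + 1) ω) - (c + d)‖ ^ 2
      = ‖(L (X n ω) - c) + (L (X (n + 1) ω - X n ω) - d)‖ ^ 2 := by
    intro ω; rw [map_sub]; congr 2; abel
  have hL2 : ∀ i, MemLp (fun y => L y - d) 2 (U.replacement i) := fun i =>
    (L.comp_memLp' (h2 i)).sub (memLp_const d)
  set C := ∑ i, ∫ y, ‖L y - d‖ ^ 2 ∂(U.replacement i) with hC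
  have hC0 : 0 ≤ C := Finset.sum_nonneg fun i _ => integral_nonneg fun y => by positivity
  calc ∫ ω in U.nonExtinctUpTo X (n + 1), ‖L (X (n + 1) ω) - (c + d)‖ ^ 2 ∂μ
      ≤ ∫ ω in U.nonExtinctUpTo X n, ‖L (X (n + 1) ω) - (c + d)‖ ^ 2 ∂μ :=
        setIntegral_mono_set hsq1 (Eventually.of_forall fun ω => by positivity)
          (nonExtinctUpTo_antitone n.le_succ).eventuallyLE
    _ = ∫ ω in U.nonExtinctUpTo X n,
          ‖(L (X n ω) - c) + (L (X (n + 1) ω - X n ω) - d)‖ ^ 2 ∂μ := by simp_rw [hgeq]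
    _ = ∫ ω in U.nonExtinctUpTo X n, ∑ i, U.drawProb (X n ω) i
          * ∫ y, ‖(L (X n ω) - c) + (L y - d)‖ ^ 2 ∂(U.replacement i) ∂μ := by
        refine (integral_increment hX hT n
          (g := fun p => ‖(L p.1 - c) + (L p.2 - d)‖ ^ 2) ?_ ?_ ?_).2
        · exact Continuous.measurable (by fun_prop)
        · exact fun x i => ((memLp_const (L x - c)).add (hL2 i)).integrable_norm_pow (by norm_num)
        · exact hsq1.congr (Eventually.of_forall hgeq)
    _ ≤ ∫ ω in U.nonExtinctUpTo X n, (‖L (X n ω) - c‖ ^ 2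
          + 2 * inner ℝ (L (X n ω) - c) (L (U.drift (X n ω)) - d) + C) ∂μ := by
        refine integral_mono_ae ?_ ((hsq0.add (hin.const_mul 2)).add (integrable_const C)) ?_
        · refine (integral_increment hX hT n
            (g := fun p => ‖(L p.1 - c) + (L p.2 - d)‖ ^ 2) ?_ ?_ ?_).1
          · exact Continuous.measurable (by fun_prop)
          · exact fun x i => ((memLp_const (L x - c)).add (hL2 i)).integrable_norm_pow (by norm_num)
          · exact hsq1.congr (Eventually.of_forall hgeq)
        · filter_upwards [ae_mem_live hX hT n] with ω hω
          rw [sum_drawProb_mul_integral_sq h2 L c d hω]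
          gcongr
          refine Finset.sum_le_sum fun i _ => ?_
          exact mul_le_of_le_one_left (integral_nonneg fun y => by positivity)
            (drawProb_le_one hω _)
    _ ≤ _ := by
        have hsin : Integrable (fun ω => ‖L (X n ω) - c‖ ^ 2
            + 2 * inner ℝ (L (X n ω) - c) (L (U.drift (X n ω)) - d))
            (μ.restrict (U.nonExtinctUpTo X n)) := hsq0.add (hin.const_mul 2)
        rw [integral_add hsin (integrable_const C),
          integral_add hsq0 (hin.const_mul 2), integral_const_mul]
        gcongr
        rw [integral_const, smul_eq_mul]
        refine mul_le_of_le_one_left hC0 ?_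
        simp only [measureReal_restrict_apply_univ]
        exact measureReal_le_one

end PolyaUrn

/-! ### Total activity: linear variance and survival with positive probability. -/

namespace PolyaUrn

variable {q : ℕ} (U : PolyaUrn q)

/-- The total activity as a continuous linear functional. -/
noncomputable def totalActivityL : EuclideanSpace ℝ (Fin q) →L[ℝ] ℝ :=
  ∑ i, U.activity i • EuclideanSpace.proj i

@[simp] lemma totalActivityL_apply (x : EuclideanSpace ℝ (Fin q)) :
    U.totalActivityL x = U.totalActivity x := by
  simp [totalActivityL, totalActivity]

variable {U}

lemma meanReplacement_apply (h2 : ∀ i, MemLp id 2 (U.replacement i)) (i j : Fin q) :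
    U.meanReplacement i j = ∫ x, x j ∂(U.replacement i) := by
  have hid : Integrable (fun y => y) (U.replacement i) := (h2 i).integrable one_le_two
  exact ((EuclideanSpace.proj (𝕜 := ℝ) j).integral_comp_comm hid).symm

lemma totalActivity_meanReplacement {b : ℝ} (h2 : ∀ i, MemLp id 2 (U.replacement i))
    (hb : U.BalancedInExpectation b) {i : Fin q} (hi : 0 < U.activity i) :
    U.totalActivity (U.meanReplacement i) = b := by
  rw [← hb.2 i hi]
  simp [totalActivity, meanReplacement_apply h2]

/-- Types of zero activity are never drawn, so balance over the types of positive activity suffices.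
-/
lemma totalActivity_drift {b : ℝ} (h2 : ∀ i, MemLp id 2 (U.replacement i))
    (hb : U.BalancedInExpectation b) {x : EuclideanSpace ℝ (Fin q)} (hx : x ∈ U.live) :
    U.totalActivity (U.drift x) = b := by
  rw [← totalActivityL_apply]
  unfold drift
  simp_rw [map_sum, map_smul, totalActivityL_apply, smul_eq_mul]
  calc _ = ∑ i, U.drawProb x i * b := by
        refine Finset.sum_congr rfl fun i _ => ?_
        rcases (U.activity_nonneg i).eq_or_lt with h | h
        · simp [drawProb, ← h]
        · rw [totalActivity_meanReplacement h2 hb h]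
    _ = b := by rw [← Finset.sum_mul, sum_drawProb hx, one_mul]

variable {Ω : Type*} [MeasurableSpace Ω] {μ : Measure Ω} {X : ℕ → Ω → EuclideanSpace ℝ (Fin q)}

/-- The total activity has variance at most linear in time. -/
lemma exists_integral_totalActivity_sq_le [IsProbabilityMeasure μ] {b : ℝ}
    (hX : U.IsUrnEvolution μ X) (hU : U.AssumptionU μ X b 2) :
    ∃ C, 0 ≤ C ∧ ∀ n : ℕ, ∫ ω in U.nonExtinctUpTo X n, (U.totalActivity (X n ω) - n * b) ^ 2 ∂μ
      ≤ C * (n + 1) := by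
  have h2 := hU.moment
  set V := ∑ i, ∫ y, ‖U.totalActivityL y - b‖ ^ 2 ∂(U.replacement i)
  have hV : 0 ≤ V := Finset.sum_nonneg fun i _ => integral_nonneg fun y => by positivity
  set v := ∫ ω in U.nonExtinctUpTo X 0, (U.totalActivity (X 0 ω)) ^ 2 ∂μ
  have hv : 0 ≤ v := integral_nonneg fun y => by positivity
  refine ⟨v + V, by positivity, fun n => ?_⟩
  suffices h : ∫ ω in U.nonExtinctUpTo X n, (U.totalActivity (X n ω) - n * b) ^ 2 ∂μ
      ≤ v + n * V by
    have : (0 : ℝ) ≤ n := n.cast_nonneg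
    nlinarith
  induction n with
  | zero => simp [v]
  | succ n ih =>
    have h := integral_norm_sq_succ_le hX hU.tenable h2 U.totalActivityL (n * b) b n
    -- Martingale property up to extinction: the activity has drift exactly b, so the cross term
    -- vanishes and each step adds at most V.
    have h0 : ∫ ω in U.nonExtinctUpTo X n, inner ℝ (U.totalActivityL (X n ω) - n * b)
        (U.totalActivityL (U.drift (X n ω)) - b) ∂μ = 0 := by
      refine integral_eq_zero_of_ae ?_
      filter_upwards [ae_mem_live hX hU.tenable n] with ω hω
      rw [totalActivityL_apply _ (U.drift _), totalActivity_drift h2 hU.balanced hω]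
      simp
    rw [h0] at h
    simp only [totalActivityL_apply, Real.norm_eq_abs, sq_abs] at h
    have e : (n : ℝ) * b + b = ((n + 1 : ℕ) : ℝ) * b := by push_cast; ring
    rw [e] at h
    push_cast at h ih ⊢
    have hVe : V = ∑ i, ∫ y, (U.totalActivity y - b) ^ 2 ∂(U.replacement i) := by
      simp [V, sq_abs]
    rw [← hVe] at h
    linarith

/-- Taylor expansion of t ↦ −1/(t + K) at s: the exact remainder is −(t − s)²/((s + K)²(t + K)), and
t + K is replaced by the smaller K. -/
lemma one_div_sub_one_div_ge {K s t : ℝ} (hK : 0 < K) (hs : 0 ≤ s) (ht : 0 ≤ t) :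
    (t - s) / (s + K) ^ 2 - (t - s) ^ 2 / (K * (s + K) ^ 2) ≤ 1 / (s + K) - 1 / (t + K) := by
  have h : 1 / (s + K) - 1 / (t + K) - ((t - s) / (s + K) ^ 2 - (t - s) ^ 2 / (K * (s + K) ^ 2))
      = (t - s) ^ 2 * t / ((s + K) ^ 2 * K * (t + K)) := by
    have : s + K ≠ 0 := by positivity
    have : t + K ≠ 0 := by positivity
    field_simp
    ring
  have : 0 ≤ (t - s) ^ 2 * t / ((s + K) ^ 2 * K * (t + K)) := by positivity
  linarith

lemma totalActivity_nonneg {x : EuclideanSpace ℝ (Fin q)} (hx : ∀ i, 0 ≤ x i) :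
    0 ≤ U.totalActivity x :=
  Finset.sum_nonneg fun i _ => mul_nonneg (U.activity_nonneg i) (hx i)

/-- A bounded function of the total activity which is a submartingale, and vanishes at
extinction. -/
lemma integral_survival_le_succ [IsProbabilityMeasure μ] {b : ℝ}
    (hX : U.IsUrnEvolution μ X) (hU : U.AssumptionU μ X b 2) {K : ℝ} (hK : 0 < K)
    (hKb : ∑ i, ∫ y, (U.totalActivity y) ^ 2 ∂(U.replacement i) ≤ K * b) (n : ℕ) :
    ∫ ω in U.nonExtinctUpTo X n, (1 / K - 1 / (U.totalActivity (X n ω) + K)) ∂μ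
      ≤ ∫ ω in U.nonExtinctUpTo X (n + 1), (1 / K - 1 / (U.totalActivity (X (n + 1) ω) + K)) ∂μ := by
  have h2 := hU.moment
  have hT := hU.tenable
  have hmS := U.measurable_totalActivity
  have hE := measurableSet_nonExtinctUpTo (U := U) hX.measurable
  have hnn : ∀ n, ∀ᵐ ω ∂μ, 0 ≤ U.totalActivity (X n ω) := fun n =>
    (hT n).mono fun ω hω => totalActivity_nonneg hω
  have hbdd : ∀ m, Integrable (fun ω => 1 / K - 1 / (U.totalActivity (X m ω) + K)) μ := by
    intro m
    refine Integrable.of_bound (C := 1 / K) ?_ ((hnn m).mono fun ω hω => ?_)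
    · have := hX.measurable m
      exact Measurable.aestronglyMeasurable (by fun_prop)
    · have h1 : 1 / (U.totalActivity (X m ω) + K) ≤ 1 / K :=
        one_div_le_one_div_of_le hK (by linarith)
      have h3 : 0 ≤ 1 / (U.totalActivity (X m ω) + K) := by positivity
      rw [Real.norm_of_nonneg (by linarith)]
      linarith
  -- On E_n without E_{n+1} the activity at time n + 1 is nonnegative by tenability but not
  -- positive, hence 0, where the function vanishes.
  have hsplit : ∫ ω in U.nonExtinctUpTo X (n + 1), (1 / K - 1 / (U.totalActivity (X (n + 1) ω) + K)) ∂μ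
      = ∫ ω in U.nonExtinctUpTo X n, (1 / K - 1 / (U.totalActivity (X (n + 1) ω) + K)) ∂μ := by
    symm
    refine setIntegral_eq_of_subset_of_ae_sdiff_eq_zero (hE n).nullMeasurableSet
      (nonExtinctUpTo_antitone n.le_succ) ?_
    filter_upwards [hnn (n + 1)] with ω hω hd
    have h0 : U.totalActivity (X (n + 1) ω) = 0 := by
      refine le_antisymm (not_lt.1 fun hpos => hd.2 fun k hk => ?_) hω
      rcases Nat.le_succ_iff.1 hk with h | rfl
      · exact hd.1 k h
      · exact hpos
    rw [h0, zero_add, sub_self]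
  -- The lower bound of `one_div_sub_one_div_ge`, quadratic in the increment, so that its mean
  -- involves only first and second moments.
  set g : EuclideanSpace ℝ (Fin q) × EuclideanSpace ℝ (Fin q) → ℝ := fun p =>
    U.totalActivity p.2 / (U.totalActivity p.1 + K) ^ 2
      - (U.totalActivity p.2) ^ 2 / (K * (U.totalActivity p.1 + K) ^ 2) with hg
  have hgm : Measurable g := by fun_prop
  have hS1 : ∀ i, Integrable (fun y => U.totalActivity y) (U.replacement i) := fun i => by
    simpa using U.totalActivityL.integrable_comp ((h2 i).integrable one_le_two)
  have hS2 : ∀ i, Integrable (fun y => (U.totalActivity y) ^ 2) (U.replacement i) := fun i => by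
    have := (U.totalActivityL.comp_memLp' (h2 i)).integrable_sq
    simpa using this
  have hgint : ∀ x i, Integrable (fun y => g (x, y)) (U.replacement i) := fun x i =>
    ((hS1 i).div_const ((U.totalActivity x + K) ^ 2)).sub
      ((hS2 i).div_const (K * (U.totalActivity x + K) ^ 2))
  have hgi : Integrable (fun ω => g (X n ω, X (n + 1) ω - X n ω))
      (μ.restrict (U.nonExtinctUpTo X n)) := by
    have hd := memLp_increment hX hT h2 n
    have h1 : Integrable (fun ω => U.totalActivity (X (n + 1) ω - X n ω))
        (μ.restrict (U.nonExtinctUpTo X n)) := by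
      simpa using U.totalActivityL.integrable_comp (hd.integrable one_le_two)
    have h3 : Integrable (fun ω => U.totalActivity (X (n + 1) ω - X n ω) ^ 2)
        (μ.restrict (U.nonExtinctUpTo X n)) := by
      have := (U.totalActivityL.comp_memLp' hd).integrable_sq
      simpa using this
    refine ((h1.norm.div_const (K ^ 2)).add (h3.div_const (K * K ^ 2))).mono'
      ((hgm.comp ((hX.measurable n).prodMk
        ((hX.measurable (n + 1)).sub (hX.measurable n)))).aestronglyMeasurable) ?_
    filter_upwards [ae_mem_live hX hT n] with ω hω
    have hpos := hω.2
    simp only [hg, Pi.add_apply]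
    have hle : K ^ 2 ≤ (U.totalActivity (X n ω) + K) ^ 2 := by gcongr; linarith
    refine (norm_sub_le _ _).trans ?_
    rw [norm_div, norm_div, Real.norm_of_nonneg (by positivity : 0 ≤ (U.totalActivity (X n ω) + K) ^ 2),
      Real.norm_of_nonneg (by positivity : 0 ≤ K * (U.totalActivity (X n ω) + K) ^ 2),
      Real.norm_of_nonneg (sq_nonneg (U.totalActivity (X (n + 1) ω - X n ω)))]
    gcongr
  -- The first-order gain comes from the drift b; `hKb` makes it outweigh the quadratic loss.
  have hge : 0 ≤ ∫ ω in U.nonExtinctUpTo X n, g (X n ω, X (n + 1) ω - X n ω) ∂μ := by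
    rw [(integral_increment hX hT n hgm hgint hgi).2]
    refine integral_nonneg_of_ae ?_
    filter_upwards [ae_mem_live hX hT n] with ω hω
    have hpos := hω.2
    have hI : ∀ i, ∫ y, g (X n ω, y) ∂(U.replacement i)
        = U.totalActivity (U.meanReplacement i) / (U.totalActivity (X n ω) + K) ^ 2
          - (∫ y, (U.totalActivity y) ^ 2 ∂(U.replacement i))
            / (K * (U.totalActivity (X n ω) + K) ^ 2) := by
      intro i
      simp only [hg]
      rw [integral_sub ((hS1 i).div_const _) ((hS2 i).div_const _), integral_div, integral_div]
      congr 2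
      have := U.totalActivityL.integral_comp_comm ((h2 i).integrable one_le_two)
      simpa [meanReplacement] using this
    have hd := totalActivity_drift h2 hU.balanced hω
    rw [← totalActivityL_apply] at hd
    unfold drift at hd
    simp_rw [map_sum, map_smul, totalActivityL_apply, smul_eq_mul] at hd
    simp only [Pi.zero_apply]
    simp_rw [hI, mul_sub, Finset.sum_sub_distrib, ← mul_div_assoc]
    rw [← Finset.sum_div, ← Finset.sum_div, hd]
    have hle : ∑ i, U.drawProb (X n ω) i * ∫ y, (U.totalActivity y) ^ 2 ∂(U.replacement i)
        ≤ K * b := by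
      refine (Finset.sum_le_sum fun i _ => ?_).trans hKb
      exact mul_le_of_le_one_left (integral_nonneg fun y => by positivity) (drawProb_le_one hω i)
    have e : b / (U.totalActivity (X n ω) + K) ^ 2
        = (K * b) / (K * (U.totalActivity (X n ω) + K) ^ 2) := by
      field_simp
    rw [e, ← sub_div]
    exact div_nonneg (by linarith) (by positivity)
  rw [hsplit]
  have hadd := integral_add (hbdd n).integrableOn hgi
  calc _ ≤ ∫ ω in U.nonExtinctUpTo X n, (1 / K - 1 / (U.totalActivity (X n ω) + K)) ∂μ
        + ∫ ω in U.nonExtinctUpTo X n, g (X n ω, X (n + 1) ω - X n ω) ∂μ := by linarith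
    _ = ∫ ω in U.nonExtinctUpTo X n, ((1 / K - 1 / (U.totalActivity (X n ω) + K))
        + g (X n ω, X (n + 1) ω - X n ω)) ∂μ := hadd.symm
    _ ≤ _ := by
        refine integral_mono_ae ((hbdd n).integrableOn.add hgi) (hbdd (n + 1)).integrableOn ?_
        filter_upwards [ae_restrict_of_ae (hnn n), ae_restrict_of_ae (hnn (n + 1))] with ω h0 h1
        have h := one_div_sub_one_div_ge hK h0 h1
        have e : U.totalActivity (X (n + 1) ω - X n ω)
            = U.totalActivity (X (n + 1) ω) - U.totalActivity (X n ω) := by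
          simp_rw [← totalActivityL_apply, map_sub]
        simp only [hg, e]
        linarith

lemma measurableSet_nonExtinct (hX : ∀ n, Measurable (X n)) :
    MeasurableSet (U.nonExtinct X) := by
  rw [← iInter_nonExtinctUpTo]
  exact MeasurableSet.iInter fun n => measurableSet_nonExtinctUpTo hX n

lemma tendsto_measure_nonExtinctUpTo [IsFiniteMeasure μ] (hX : ∀ n, Measurable (X n)) :
    Tendsto (fun n => μ (U.nonExtinctUpTo X n)) atTop (𝓝 (μ (U.nonExtinct X))) := by
  rw [← iInter_nonExtinctUpTo]
  exact tendsto_measure_iInter_atTop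
    (fun n => (measurableSet_nonExtinctUpTo hX n).nullMeasurableSet) nonExtinctUpTo_antitone
    ⟨0, measure_ne_top _ _⟩

/-- The urn survives with positive probability. -/
lemma measure_nonExtinct_pos [IsProbabilityMeasure μ] {b : ℝ}
    (hX : U.IsUrnEvolution μ X) (hU : U.AssumptionU μ X b 2) : 0 < μ (U.nonExtinct X) := by
  have hb := hU.balanced.1
  set C := ∑ i, ∫ y, (U.totalActivity y) ^ 2 ∂(U.replacement i)
  have hC : 0 ≤ C := Finset.sum_nonneg fun i _ => integral_nonneg fun y => by positivity
  obtain ⟨K, hK, hKb⟩ : ∃ K : ℝ, 0 < K ∧ C ≤ K * b :=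
    ⟨C / b + 1, by positivity, by rw [add_mul, div_mul_cancel₀ _ hb.ne']; linarith⟩
  set s := U.totalActivity U.initial
  have hs : 0 < s := U.initial_activity_pos
  set δ := 1 / K - 1 / (s + K)
  have hδ : 0 < δ := sub_pos.2 (one_div_lt_one_div_of_lt hK (by linarith))
  have h0 : ∫ ω in U.nonExtinctUpTo X 0, (1 / K - 1 / (U.totalActivity (X 0 ω) + K)) ∂μ = δ := by
    have hE0 : ∀ᵐ ω ∂μ, ω ∈ U.nonExtinctUpTo X 0 := by
      filter_upwards [hX.initial] with ω hω k hk
      obtain rfl : k = 0 := by omega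
      rw [hω]; exact hs
    rw [setIntegral_congr_set (s := U.nonExtinctUpTo X 0) (t := Set.univ) (eventuallyEq_univ.2 hE0), setIntegral_univ]
    calc _ = ∫ _, δ ∂μ := integral_congr_ae (hX.initial.mono fun ω hω => by simp [hω, δ, s])
      _ = δ := by simp
  have hn : ∀ n, δ ≤ ∫ ω in U.nonExtinctUpTo X n, (1 / K - 1 / (U.totalActivity (X n ω) + K)) ∂μ := by
    intro n
    induction n with
    | zero => exact h0.ge
    | succ n ih => exact ih.trans (integral_survival_le_succ hX hU hK hKb n)
  -- The integrand is at most 1/K, so an integral of at least δ needs an event of probability at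
  -- least Kδ.
  have hm : ∀ n, ENNReal.ofReal (K * δ) ≤ μ (U.nonExtinctUpTo X n) := by
    intro n
    have h1 : ∫ ω in U.nonExtinctUpTo X n, (1 / K - 1 / (U.totalActivity (X n ω) + K)) ∂μ
        ≤ ∫ _ in U.nonExtinctUpTo X n, 1 / K ∂μ := by
      refine integral_mono_of_nonneg ?_ (integrable_const _) ?_
      · filter_upwards [ae_mem_live hX hU.tenable n] with ω hω
        have := hω.2
        exact sub_nonneg.2 (one_div_le_one_div_of_le hK (by linarith))
      · filter_upwards [ae_mem_live hX hU.tenable n] with ω hω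
        have := hω.2
        have : 0 ≤ 1 / (U.totalActivity (X n ω) + K) := by positivity
        linarith
    have h3 := (hn n).trans h1
    rw [setIntegral_const, smul_eq_mul, mul_one_div, le_div_iff₀ hK] at h3
    rw [← ofReal_measureReal]
    exact ENNReal.ofReal_le_ofReal (by linarith)
  exact (ENNReal.ofReal_pos.2 (mul_pos hK hδ)).trans_le
    (ge_of_tendsto' (tendsto_measure_nonExtinctUpTo hX.measurable) hm)

end PolyaUrn

/-! ### Linear growth of second moments along covectors with 2 Re z < b. -/

namespace PolyaUrn

variable {q : ℕ} (U : PolyaUrn q)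

/-- The real-linear functional on compositions given by a complex covector. -/
noncomputable def pair (u : Fin q → ℂ) : EuclideanSpace ℝ (Fin q) →L[ℝ] ℂ :=
  ∑ i, (EuclideanSpace.proj (𝕜 := ℝ) i).smulRight (u i)

lemma pair_apply (u : Fin q → ℂ) (x : EuclideanSpace ℝ (Fin q)) :
    pair u x = ∑ i, u i * x i := by
  simp [pair, mul_comm]

/-- The transpose of the intensity matrix, acting on complex covectors. -/
noncomputable def dualIntensity : Module.End ℂ (Fin q → ℂ) :=
  Matrix.toLin' (U.intensity.map (algebraMap ℝ ℂ))ᵀ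

variable {U}

lemma dualIntensity_apply (h2 : ∀ i, MemLp id 2 (U.replacement i)) (u : Fin q → ℂ) (j : Fin q) :
    U.dualIntensity u j = U.activity j * pair u (U.meanReplacement j) := by
  simp only [dualIntensity, Matrix.toLin'_apply, Matrix.mulVec, dotProduct, Matrix.transpose_apply,
    Matrix.map_apply, intensity, Matrix.of_apply, pair_apply, Finset.mul_sum,
    meanReplacement_apply h2, Complex.coe_algebraMap, Complex.ofReal_mul]
  exact Finset.sum_congr rfl fun i _ => by ring

/-- The dual form of drift x = Ax/(a·x): the factor a·x cancels the denominators of the draw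
probabilities. -/
lemma totalActivity_mul_pair_drift (h2 : ∀ i, MemLp id 2 (U.replacement i)) (u : Fin q → ℂ)
    {x : EuclideanSpace ℝ (Fin q)} (hx : x ∈ U.live) :
    U.totalActivity x • pair u (U.drift x) = pair (U.dualIntensity u) x := by
  rw [pair_apply (U.dualIntensity u), drift, map_sum, Finset.smul_sum]
  refine Finset.sum_congr rfl fun i _ => ?_
  rw [dualIntensity_apply h2, map_smul, smul_smul, drawProb, mul_div_cancel₀ _ hx.2.ne',
    Complex.real_smul, Complex.ofReal_mul]
  ring

variable {Ω : Type*} [MeasurableSpace Ω] {μ : Measure Ω} {X : ℕ → Ω → EuclideanSpace ℝ (Fin q)}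

variable (U μ X) in
/-- The functional `u` of the composition has a second moment that grows at most linearly. -/
def LinearSecondMoment (u : Fin q → ℂ) : Prop :=
  ∃ K, ∀ n : ℕ, ∫ ω in U.nonExtinctUpTo X n, ‖pair u (X n ω)‖ ^ 2 ∂μ ≤ K * (n + 1)

lemma linearSecondMoment_zero : LinearSecondMoment U μ X 0 := by
  refine ⟨0, fun n => ?_⟩
  have : ∀ x, pair (0 : Fin q → ℂ) x = 0 := fun x => by simp [pair_apply]
  simp [this]

/-- Induction on w n ≤ K n: a step adds at most max r 0 · K + D, which the choice of K makes at most
K. Division by n forces a start at 1, so w 0 is covered separately. -/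
lemma exists_le_mul_of_le_add_div {w : ℕ → ℝ} {r D : ℝ} (hr : r < 1) (hw : ∀ n, 0 ≤ w n)
    (h : ∀ n : ℕ, 1 ≤ n → w (n + 1) ≤ w n + r * w n / n + D) :
    ∃ K, ∀ n : ℕ, w n ≤ K * (n + 1) := by
  obtain ⟨K, h0, h1, hD⟩ : ∃ K, w 0 ≤ K ∧ w 1 ≤ K ∧ D ≤ K * (1 - max r 0) := by
    have h1r : 0 < 1 - max r 0 := sub_pos.2 (max_lt hr one_pos)
    refine ⟨max (max (w 0) (w 1)) (D / (1 - max r 0)), ?_, ?_, ?_⟩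
    · exact (le_max_left _ _).trans (le_max_left _ _)
    · exact (le_max_right _ _).trans (le_max_left _ _)
    · rw [← div_le_iff₀ h1r]; exact le_max_right _ _
  have hK : 0 ≤ K := (hw 0).trans h0
  have key : ∀ n : ℕ, 1 ≤ n → w n ≤ K * n := by
    intro n hn
    induction n, hn using Nat.le_induction with
    | base => simpa using h1
    | succ n hn ih =>
      have hn' : (0 : ℝ) < n := by exact_mod_cast hn
      have h3 : r * w n / n ≤ max r 0 * K := by
        rw [div_le_iff₀ hn', mul_assoc]
        exact mul_le_mul (le_max_left _ _) ih (hw n) (le_max_right _ _)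
      have := h n hn
      push_cast
      linarith
  refine ⟨K, fun n => ?_⟩
  rcases Nat.eq_zero_or_pos n with rfl | hn
  · simpa using h0
  · have := key n hn
    linarith

lemma two_mul_mul_le_add_sq {η : ℝ} (hη : 0 < η) (x y : ℝ) :
    2 * x * y ≤ η * x ^ 2 + y ^ 2 / η := by
  have h : 0 ≤ (η * x - y) ^ 2 / η := by positivity
  have e : (η * x - y) ^ 2 / η = η * x ^ 2 + y ^ 2 / η - 2 * x * y := by
    field_simp; ring
  linarith

/-- The mean displacement of a functional along its own direction, when the corresponding
eigenvalue has a real part smaller than `b / 2`. -/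
lemma exists_two_mul_inner_drift_le (h2 : ∀ i, MemLp id 2 (U.replacement i)) {b : ℝ} (hb : 0 < b)
    {z : ℂ} (hz : 2 * z.re < b) (u : Fin q → ℂ) :
    ∃ r c₁ c₂ : ℝ, r < 1 ∧ 0 ≤ c₁ ∧ 0 ≤ c₂ ∧ ∀ n : ℕ, 1 ≤ n → ∀ x ∈ U.live,
      2 * inner ℝ (pair u x) (pair u (U.drift x)) ≤
        (r * ‖pair u x‖ ^ 2 + c₁ * ‖pair (U.dualIntensity u - z • u) x‖ ^ 2
          + c₂ * (U.totalActivity x - n * b) ^ 2) / n := by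
  -- A nonnegative γ in place of Re z permits replacing s by its lower bound θbn below.
  obtain ⟨γ, hγ0, hzγ, hγb⟩ : ∃ γ : ℝ, 0 ≤ γ ∧ z.re ≤ γ ∧ 2 * γ < b := by
    refine ⟨max z.re 0, le_max_right _ _, le_max_left _ _, ?_⟩
    rcases max_choice z.re 0 with h | h <;> rw [h] <;> linarith
  -- Taking θ above 2γ/b keeps ρ = 2γ/(θb) below 1. Half of the gap 1 − ρ, namely η, is reserved for
  -- the cross terms.
  obtain ⟨θ, hγθ, hθ1⟩ := exists_between ((div_lt_one hb).2 hγb)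
  have hθ0 : 0 < θ := lt_of_le_of_lt (by positivity) hγθ
  have hθb : 0 < θ * b := by positivity
  set ρ := 2 * γ / (θ * b)
  have hρ : ρ < 1 := by
    rw [div_lt_one hθb]; rwa [div_lt_iff₀ hb] at hγθ
  have hρ0 : 0 ≤ ρ := by positivity
  set η := (1 - ρ) / 2 with hη
  have hη0 : 0 < η := by linarith
  set M := ‖pair u‖ * ∑ i, ‖U.meanReplacement i‖
  have hM : 0 ≤ M := by positivity
  set c₁ := 1 / (θ * b) ^ 2 / η with hc₁
  set c₂ := (M / ((1 - θ) * b)) ^ 2 / η with hc₂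
  refine ⟨ρ + η, c₁, c₂, by linarith, by positivity, by positivity, fun n hn x hx => ?_⟩
  have hn' : (0 : ℝ) < n := by exact_mod_cast hn
  have hs := hx.2
  set s := U.totalActivity x
  set f := pair u x
  set f' := pair (U.dualIntensity u - z • u) x with hf'
  have hf : s • pair u (U.drift x) = z * f + f' := by
    rw [totalActivity_mul_pair_drift h2 u hx, hf']
    simp only [pair_apply, f, Pi.sub_apply, Pi.smul_apply, smul_eq_mul, sub_mul,
      Finset.sum_sub_distrib, Finset.mul_sum, mul_assoc]
    ring
  have hin : s * inner ℝ f (pair u (U.drift x)) = z.re * ‖f‖ ^ 2 + inner ℝ f f' := by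
    rw [← real_inner_smul_right, hf, inner_add_right]
    congr 1
    rw [Complex.inner, ← Complex.normSq_eq_norm_sq, Complex.normSq_apply]
    simp
    ring
  rw [le_div_iff₀ hn']
  -- If s ≥ θbn, the linear formula divided by s gains a factor 1/(θbn). Otherwise nb − s > (1 −
  -- θ)bn, and the crude bound M on the drift is paid for by the deviation of the activity.
  rcases le_or_gt (θ * b * n) s with hcase | hcase
  · have h1 : s * inner ℝ f (pair u (U.drift x)) ≤ γ * ‖f‖ ^ 2 + ‖f‖ * ‖f'‖ := by
      rw [hin]
      gcongr
      exact real_inner_le_norm _ _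
    have h3 : n * inner ℝ f (pair u (U.drift x)) ≤ (γ * ‖f‖ ^ 2 + ‖f‖ * ‖f'‖) / (θ * b) := by
      rw [le_div_iff₀ hθb]
      rcases le_or_gt (inner ℝ f (pair u (U.drift x))) 0 with hneg | hpos
      · have : n * inner ℝ f (pair u (U.drift x)) * (θ * b) ≤ 0 :=
          mul_nonpos_of_nonpos_of_nonneg (mul_nonpos_of_nonneg_of_nonpos hn'.le hneg) hθb.le
        have : 0 ≤ γ * ‖f‖ ^ 2 + ‖f‖ * ‖f'‖ := by positivity
        linarith
      · have := mul_le_mul_of_nonneg_right hcase hpos.le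
        linarith
    have h4 := two_mul_mul_le_add_sq hη0 ‖f‖ (‖f'‖ / (θ * b))
    have e1 : 2 * ((γ * ‖f‖ ^ 2 + ‖f‖ * ‖f'‖) / (θ * b))
        = ρ * ‖f‖ ^ 2 + 2 * ‖f‖ * (‖f'‖ / (θ * b)) := by
      simp only [ρ]; field_simp
    have e2 : (‖f'‖ / (θ * b)) ^ 2 / η = c₁ * ‖f'‖ ^ 2 := by
      rw [hc₁]; field_simp
    have : 0 ≤ c₂ * (s - n * b) ^ 2 := by positivity
    linarith
  · have h1 : inner ℝ f (pair u (U.drift x)) ≤ ‖f‖ * M := by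
      refine (real_inner_le_norm _ _).trans (mul_le_mul_of_nonneg_left ?_ (norm_nonneg _))
      exact ((pair u).le_opNorm _).trans
        (mul_le_mul_of_nonneg_left (norm_drift_le hx) (norm_nonneg _))
    have h1θ : 0 < (1 - θ) * b := mul_pos (by linarith) hb
    have h3 : n ≤ (n * b - s) / ((1 - θ) * b) := by
      rw [le_div_iff₀ h1θ]; linarith
    have h4 := two_mul_mul_le_add_sq hη0 ‖f‖ (M * ((n * b - s) / ((1 - θ) * b)))
    have h5 : 2 * inner ℝ f (pair u (U.drift x)) * n
        ≤ 2 * ‖f‖ * (M * ((n * b - s) / ((1 - θ) * b))) := by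
      have h6 : inner ℝ f (pair u (U.drift x)) * n ≤ ‖f‖ * M * n :=
        mul_le_mul_of_nonneg_right h1 hn'.le
      have h7 : ‖f‖ * M * n ≤ ‖f‖ * M * ((n * b - s) / ((1 - θ) * b)) :=
        mul_le_mul_of_nonneg_left h3 (by positivity)
      linarith
    have e2 : (M * ((n * b - s) / ((1 - θ) * b))) ^ 2 / η = c₂ * (s - n * b) ^ 2 := by
      rw [hc₂]; field_simp; ring
    have : 0 ≤ c₁ * ‖f'‖ ^ 2 := by positivity
    have : 0 ≤ ρ * ‖f‖ ^ 2 := by positivity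
    linarith

lemma LinearSecondMoment.of_dualIntensity_sub_smul [IsProbabilityMeasure μ] {b : ℝ}
    (hX : U.IsUrnEvolution μ X) (hU : U.AssumptionU μ X b 2) {z : ℂ} (hz : 2 * z.re < b)
    {u : Fin q → ℂ} (hu : LinearSecondMoment U μ X (U.dualIntensity u - z • u)) :
    LinearSecondMoment U μ X u := by
  have h2 := hU.moment
  have hT := hU.tenable
  obtain ⟨K, hK⟩ := hu
  obtain ⟨C, hC0, hC⟩ := exists_integral_totalActivity_sq_le hX hU
  obtain ⟨r, c₁, c₂, hr, hc₁, hc₂, hle⟩ := exists_two_mul_inner_drift_le h2 hU.balanced.1 hz u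
  have hK0 : 0 ≤ K := by
    have := (integral_nonneg fun ω => by positivity).trans (hK 0)
    simpa using this
  set V := ∑ i, ∫ y, ‖pair u y‖ ^ 2 ∂(U.replacement i)
  refine exists_le_mul_of_le_add_div (r := r) (D := 2 * (c₁ * K + c₂ * C) + V) hr
    (fun n => integral_nonneg fun ω => by positivity) fun n hn => ?_
  have hn' : (0 : ℝ) < n := by exact_mod_cast hn
  have hn1 : (1 : ℝ) ≤ n := by exact_mod_cast hn
  have hL2 := memLp_composition hX hT h2 n
  -- No centring is needed: the covectors used later kill v₁, hence also the centre nb v₁.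
  have hstep := integral_norm_sq_succ_le hX hT h2 (pair u) 0 0 n
  have hin := integrable_inner_drift hX hT h2 (pair u) 0 0 n
  simp only [sub_zero, add_zero] at hstep hin
  have hi1 : Integrable (fun ω => ‖pair u (X n ω)‖ ^ 2) (μ.restrict (U.nonExtinctUpTo X n)) :=
    ((pair u).comp_memLp' hL2).integrable_norm_pow (by norm_num)
  have hi2 : Integrable (fun ω => ‖pair (U.dualIntensity u - z • u) (X n ω)‖ ^ 2)
      (μ.restrict (U.nonExtinctUpTo X n)) :=
    ((pair _).comp_memLp' hL2).integrable_norm_pow (by norm_num)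
  have hi3 : Integrable (fun ω => (U.totalActivity (X n ω) - n * b) ^ 2)
      (μ.restrict (U.nonExtinctUpTo X n)) := by
    have := ((U.totalActivityL.comp_memLp' hL2).sub (memLp_const ((n : ℝ) * b))).integrable_sq
    simpa using this
  have hi12 : Integrable (fun ω => r * ‖pair u (X n ω)‖ ^ 2
      + c₁ * ‖pair (U.dualIntensity u - z • u) (X n ω)‖ ^ 2)
      (μ.restrict (U.nonExtinctUpTo X n)) := (hi1.const_mul r).add (hi2.const_mul c₁)
  have hmain : 2 * ∫ ω in U.nonExtinctUpTo X n,
      inner ℝ (pair u (X n ω)) (pair u (U.drift (X n ω))) ∂μ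
      ≤ (r * ∫ ω in U.nonExtinctUpTo X n, ‖pair u (X n ω)‖ ^ 2 ∂μ
        + c₁ * ∫ ω in U.nonExtinctUpTo X n, ‖pair (U.dualIntensity u - z • u) (X n ω)‖ ^ 2 ∂μ
        + c₂ * ∫ ω in U.nonExtinctUpTo X n, (U.totalActivity (X n ω) - n * b) ^ 2 ∂μ) / n := by
    rw [← integral_const_mul, ← integral_const_mul, ← integral_const_mul, ← integral_const_mul,
      ← integral_add (hi1.const_mul r) (hi2.const_mul c₁), ← integral_add hi12 (hi3.const_mul c₂),
      ← integral_div]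
    exact integral_mono_ae (hin.const_mul 2) ((hi12.add (hi3.const_mul c₂)).div_const _)
      ((ae_mem_live hX hT n).mono fun ω hω => hle n hn _ hω)
  -- The factor 2 bounds (n + 1)/n for n ≥ 1.
  have hrest : (c₁ * ∫ ω in U.nonExtinctUpTo X n,
        ‖pair (U.dualIntensity u - z • u) (X n ω)‖ ^ 2 ∂μ
      + c₂ * ∫ ω in U.nonExtinctUpTo X n, (U.totalActivity (X n ω) - n * b) ^ 2 ∂μ) / n
      ≤ 2 * (c₁ * K + c₂ * C) := by
    rw [div_le_iff₀ hn']
    have h1 := mul_le_mul_of_nonneg_left (hK n) hc₁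
    have h3 := mul_le_mul_of_nonneg_left (hC n) hc₂
    have h4 : 0 ≤ (c₁ * K + c₂ * C) * (n - 1) :=
      mul_nonneg (by positivity) (by linarith)
    linarith
  have e := add_div (r * ∫ ω in U.nonExtinctUpTo X n, ‖pair u (X n ω)‖ ^ 2 ∂μ)
    (c₁ * ∫ ω in U.nonExtinctUpTo X n, ‖pair (U.dualIntensity u - z • u) (X n ω)‖ ^ 2 ∂μ
      + c₂ * ∫ ω in U.nonExtinctUpTo X n, (U.totalActivity (X n ω) - n * b) ^ 2 ∂μ) (n : ℝ)
  rw [← add_assoc] at e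
  linarith

end PolyaUrn

/-! ### Spectral argument and the mean-square bound for the composition. -/

namespace PolyaUrn

variable {q : ℕ} {U : PolyaUrn q}
variable {Ω : Type*} [MeasurableSpace Ω] {μ : Measure Ω} {X : ℕ → Ω → EuclideanSpace ℝ (Fin q)}

/-- Each factor T − z is moved onto u and then removed by `of_dualIntensity_sub_smul`; this treats
Jordan blocks without choosing a basis. -/
lemma LinearSecondMoment.of_aeval_prod [IsProbabilityMeasure μ] {b : ℝ}
    (hX : U.IsUrnEvolution μ X) (hU : U.AssumptionU μ X b 2) (s : Multiset ℂ)
    (hs : ∀ z ∈ s, 2 * z.re < b) {u : Fin q → ℂ}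
    (hu : LinearSecondMoment U μ X (Polynomial.aeval U.dualIntensity
      (s.map fun z => Polynomial.X - Polynomial.C z).prod u)) :
    LinearSecondMoment U μ X u := by
  induction s using Multiset.induction_on generalizing u with
  | empty => simpa using hu
  | cons z s ih =>
    refine LinearSecondMoment.of_dualIntensity_sub_smul hX hU (hs z (Multiset.mem_cons_self z s))
      (ih (fun w hw => hs w (Multiset.mem_cons_of_mem hw)) ?_)
    rw [Multiset.map_cons, Multiset.prod_cons, mul_comm, map_mul, Module.End.mul_apply] at hu
    simpa [Module.algebraMap_end_apply] using hu

/-- The complexification of the activity vector. -/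
noncomputable def complexActivity (U : PolyaUrn q) : Fin q → ℂ := fun i => U.activity i

/-- Balance makes a a left eigenvector of A; coordinates of zero activity vanish on both sides. -/
lemma dualIntensity_complexActivity {b : ℝ} (h2 : ∀ i, MemLp id 2 (U.replacement i))
    (hb : U.BalancedInExpectation b) :
    U.dualIntensity U.complexActivity = (b : ℂ) • U.complexActivity := by
  ext j
  rw [dualIntensity_apply h2, Pi.smul_apply, smul_eq_mul]
  rcases (U.activity_nonneg j).eq_or_lt with h | h
  · simp [complexActivity, ← h]
  · have : pair U.complexActivity (U.meanReplacement j) = b := by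
      rw [← totalActivity_meanReplacement h2 hb h, pair_apply, totalActivity]
      simp [complexActivity]
    rw [this, complexActivity, mul_comm]

/-- Pairing with a right eigenvector turns T into multiplication by b, so the covectors killing v
form a T-invariant subspace. -/
lemma pair_dualIntensity {b : ℝ} {v : EuclideanSpace ℝ (Fin q)}
    (hv : U.intensity *ᵥ v.ofLp = b • v.ofLp) (u : Fin q → ℂ) :
    pair (U.dualIntensity u) v = b * pair u v := by
  have hv' : ∀ i, ∑ j, (U.intensity i j : ℂ) * v j = b * v i := fun i => by
    have := congrFun hv i
    simp only [Matrix.mulVec, dotProduct, Pi.smul_apply, smul_eq_mul] at this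
    exact_mod_cast this
  simp only [pair_apply, dualIntensity, Matrix.toLin'_apply, Matrix.mulVec, dotProduct,
    Matrix.transpose_apply, Matrix.map_apply, Complex.coe_algebraMap, Finset.sum_mul,
    Finset.mul_sum]
  rw [Finset.sum_comm]
  refine Finset.sum_congr rfl fun i _ => ?_
  calc _ = u i * ∑ j, (U.intensity i j : ℂ) * v j := by
        rw [Finset.mul_sum]; exact Finset.sum_congr rfl fun j _ => by ring
    _ = _ := by rw [hv' i]; ring

/-- Covectors annihilating the leading eigenvector are annihilated by the product of
the factors corresponding to the other eigenvalues. -/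
lemma aeval_dualIntensity_eq_zero {b : ℝ} (h2 : ∀ i, MemLp id 2 (U.replacement i))
    (hb : U.BalancedInExpectation b) (hlead : U.IsLeadingEigenvalue b) (hsmall : U.StrictlySmall b)
    {v : EuclideanSpace ℝ (Fin q)} (hv : U.intensity *ᵥ v.ofLp = b • v.ofLp)
    (hav : ∑ i, U.activity i * v i = 1) {u : Fin q → ℂ} (hu : pair u v = 0) :
    Polynomial.aeval U.dualIntensity
      ((U.eigenvalues.erase (b : ℂ)).map fun z => Polynomial.X - Polynomial.C z).prod u = 0 := by
  set T := U.dualIntensity with hT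
  set R := ((U.eigenvalues.erase (b : ℂ)).map fun z => Polynomial.X - Polynomial.C z).prod
  have hcp : T.charpoly = (U.intensity.map (algebraMap ℝ ℂ)).charpoly := by
    rw [hT, dualIntensity, Matrix.charpoly_toLin', Matrix.charpoly_transpose]
  have hroots : T.charpoly.roots = U.eigenvalues := by rw [hcp]; rfl
  have hfac : T.charpoly = (Polynomial.X - Polynomial.C (b : ℂ)) * R := by
    rw [(IsAlgClosed.splits T.charpoly).eq_prod_roots_of_monic T.charpoly_monic, hroots,
      ← Multiset.cons_erase hlead.1, Multiset.map_cons, Multiset.prod_cons]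
  have hker : ∀ (P : Polynomial ℂ) (w : Fin q → ℂ), pair w v = 0 →
      pair (Polynomial.aeval T P w) v = 0 := by
    intro P w hw
    have hadd : ∀ w₁ w₂ : Fin q → ℂ, pair (w₁ + w₂) v = pair w₁ v + pair w₂ v := fun w₁ w₂ => by
      simp [pair_apply, add_mul, Finset.sum_add_distrib]
    have hsmul : ∀ (c : ℂ) (w₁ : Fin q → ℂ), pair (c • w₁) v = c * pair w₁ v := fun c w₁ => by
      simp [pair_apply, Finset.mul_sum, mul_assoc]
    induction P using Polynomial.induction_on' with
    | add p r hp hr => rw [map_add, LinearMap.add_apply, hadd, hp, hr, add_zero]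
    | monomial n c =>
      rw [Polynomial.aeval_monomial, Module.End.mul_apply, Module.algebraMap_end_apply, hsmul]
      have : ∀ n : ℕ, pair ((T ^ n) w) v = 0 := by
        intro n
        induction n with
        | zero => simpa using hw
        | succ n ih => rw [pow_succ', Module.End.mul_apply, pair_dualIntensity hv, ih, mul_zero]
      rw [this, mul_zero]
  set w := Polynomial.aeval T R u
  -- Cayley–Hamilton: (T − b) R(T) = 0.
  have hTw : T w = (b : ℂ) • w := by
    have h := congrArg (fun f : Module.End ℂ (Fin q → ℂ) => f u) T.aeval_self_charpoly
    simp only [hfac, map_mul, Module.End.mul_apply] at h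
    simpa [Module.algebraMap_end_apply, sub_eq_zero] using h
  have hav' : pair U.complexActivity v = 1 := by
    rw [pair_apply]
    simp only [complexActivity]
    exact_mod_cast hav
  -- A second copy of b would satisfy 2b < b. Hence the eigenspace of b is the line of the activity
  -- covector, on which pairing with v is injective, whereas w pairs to zero.
  have hmult : T.charpoly.rootMultiplicity (b : ℂ) = 1 := by
    have h0 : (b : ℂ) ∉ U.eigenvalues.erase (b : ℂ) := fun h => by
      have := hsmall _ h
      rw [Complex.ofReal_re] at this
      linarith [hb.1]
    rw [← Polynomial.count_roots, hroots, ← Multiset.cons_erase hlead.1, Multiset.count_cons_self,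
      Multiset.count_eq_zero_of_notMem h0]
  have hrank : Module.finrank ℂ (T.eigenspace (b : ℂ)) ≤ 1 :=
    (LinearMap.finrank_eigenspace_le T _).trans hmult.le
  obtain ⟨e, he⟩ := finrank_le_one_iff.1 hrank
  obtain ⟨c, hc⟩ := he ⟨w, Module.End.mem_eigenspace_iff.2 hTw⟩
  obtain ⟨d, hd⟩ := he ⟨U.complexActivity,
    Module.End.mem_eigenspace_iff.2 (dualIntensity_complexActivity h2 hb)⟩
  have hc' : c • (e : Fin q → ℂ) = w := congrArg Subtype.val hc
  have hd' : d • (e : Fin q → ℂ) = U.complexActivity := congrArg Subtype.val hd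
  have hsmul : ∀ (c : ℂ) (w₁ : Fin q → ℂ), pair (c • w₁) v = c * pair w₁ v := fun c w₁ => by
    simp [pair_apply, Finset.mul_sum, mul_assoc]
  have hev : pair (e : Fin q → ℂ) v ≠ 0 := fun h => by
    rw [← hd', hsmul, h, mul_zero] at hav'
    exact zero_ne_one hav'
  have hwv : pair w v = 0 := hker R u hu
  rw [← hc', hsmul] at hwv
  rw [← hc', (mul_eq_zero.1 hwv).resolve_right hev, zero_smul]

/-- The fluctuations of the composition are at most of order `√n` in mean square. -/
lemma exists_integral_norm_sub_sq_le [IsProbabilityMeasure μ] {b : ℝ}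
    (hX : U.IsUrnEvolution μ X) (hU : U.AssumptionU μ X b 2) (hsmall : U.StrictlySmall b)
    {v : EuclideanSpace ℝ (Fin q)} (hv : U.intensity *ᵥ v.ofLp = b • v.ofLp)
    (hav : ∑ i, U.activity i * v i = 1) :
    ∃ K, ∀ n : ℕ, ∫ ω in U.nonExtinctUpTo X n, ‖X n ω - ((n : ℝ) * b) • v‖ ^ 2 ∂μ
      ≤ K * (n + 1) := by
  have h2 := hU.moment
  obtain ⟨C, hC0, hC⟩ := exists_integral_totalActivity_sq_le hX hU
  -- `u i` reads off x_i − v_i (a·x), so it kills v because a·v = 1. Adding v_i times the centred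
  -- activity gives x_i − nb v_i.
  let u : Fin q → Fin q → ℂ := fun i => Pi.single i 1 - (v i : ℂ) • U.complexActivity
  have hpair : ∀ i x, pair (u i) x = ((x i - v i * U.totalActivity x : ℝ) : ℂ) := by
    intro i x
    simp [u, pair_apply, sub_mul, Finset.sum_sub_distrib, Pi.single_apply, totalActivity,
      complexActivity, Finset.mul_sum, mul_assoc]
  have hu0 : ∀ i, pair (u i) v = 0 := fun i => by
    rw [hpair, totalActivity, hav]; simp
  have hgood : ∀ i, LinearSecondMoment U μ X (u i) := fun i => by
    refine LinearSecondMoment.of_aeval_prod hX hU (U.eigenvalues.erase (b : ℂ)) hsmall ?_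
    rw [aeval_dualIntensity_eq_zero h2 hU.balanced hU.leading hsmall hv hav (hu0 i)]
    exact linearSecondMoment_zero
  choose K hK using hgood
  refine ⟨∑ i, (2 * K i + 2 * v i ^ 2 * C), fun n => ?_⟩
  have hL2 := memLp_composition hX hU.tenable h2 n
  have hi1 : ∀ i, Integrable (fun ω => ‖pair (u i) (X n ω)‖ ^ 2)
      (μ.restrict (U.nonExtinctUpTo X n)) := fun i =>
    ((pair (u i)).comp_memLp' hL2).integrable_norm_pow (by norm_num)
  have hi3 : Integrable (fun ω => (U.totalActivity (X n ω) - n * b) ^ 2)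
      (μ.restrict (U.nonExtinctUpTo X n)) := by
    have := ((U.totalActivityL.comp_memLp' hL2).sub (memLp_const ((n : ℝ) * b))).integrable_sq
    simpa using this
  have hi : ∀ i, Integrable (fun ω => 2 * ‖pair (u i) (X n ω)‖ ^ 2
      + 2 * v i ^ 2 * (U.totalActivity (X n ω) - n * b) ^ 2)
      (μ.restrict (U.nonExtinctUpTo X n)) := fun i =>
    ((hi1 i).const_mul 2).add (hi3.const_mul (2 * v i ^ 2))
  calc ∫ ω in U.nonExtinctUpTo X n, ‖X n ω - ((n : ℝ) * b) • v‖ ^ 2 ∂μ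
      ≤ ∫ ω in U.nonExtinctUpTo X n, ∑ i, (2 * ‖pair (u i) (X n ω)‖ ^ 2
          + 2 * v i ^ 2 * (U.totalActivity (X n ω) - n * b) ^ 2) ∂μ := by
        refine integral_mono_of_nonneg (Eventually.of_forall fun ω => by positivity)
          (integrable_finsetSum _ fun i _ => hi i) (Eventually.of_forall fun ω => ?_)
        simp only [EuclideanSpace.norm_sq_eq]
        refine Finset.sum_le_sum fun i _ => ?_
        rw [hpair, Complex.norm_real, Real.norm_eq_abs, Real.norm_eq_abs, sq_abs, sq_abs]
        simp only [PiLp.sub_apply, PiLp.smul_apply, smul_eq_mul]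
        have := sq_nonneg ((X n ω i - v i * U.totalActivity (X n ω))
          - v i * (U.totalActivity (X n ω) - n * b))
        linarith
    _ = ∑ i, (2 * ∫ ω in U.nonExtinctUpTo X n, ‖pair (u i) (X n ω)‖ ^ 2 ∂μ
          + 2 * v i ^ 2 * ∫ ω in U.nonExtinctUpTo X n,
            (U.totalActivity (X n ω) - n * b) ^ 2 ∂μ) := by
        rw [integral_finsetSum _ fun i _ => hi i]
        refine Finset.sum_congr rfl fun i _ => ?_
        rw [integral_add ((hi1 i).const_mul 2) (hi3.const_mul (2 * v i ^ 2)), integral_const_mul,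
          integral_const_mul]
    _ ≤ ∑ i, (2 * (K i * (n + 1)) + 2 * v i ^ 2 * (C * (n + 1))) := by
        gcongr with i
        · exact hK i n
        · exact hC n
    _ = _ := by
        rw [Finset.sum_mul]
        exact Finset.sum_congr rfl fun i _ => by ring

end PolyaUrn

/-! ### Change of conditioning, shifts of weak limits, and convergence of means. -/

namespace PolyaUrn

variable {q : ℕ} {U : PolyaUrn q}
variable {Ω : Type*} [MeasurableSpace Ω] {μ : Measure Ω} {X : ℕ → Ω → EuclideanSpace ℝ (Fin q)}

lemma integral_cond (μ : Measure Ω) (s : Set Ω) (g : Ω → ℝ) :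
    ∫ ω, g ω ∂(ProbabilityTheory.cond μ s) = (μ.real s)⁻¹ * ∫ ω in s, g ω ∂μ := by
  rw [ProbabilityTheory.cond, integral_smul_measure, ENNReal.toReal_inv, smul_eq_mul]
  rfl

/-- Conditioning on events decreasing to an event of positive probability is asymptotically the
same as conditioning on the limit event. -/
lemma tendsto_integral_cond_sub {μ : Measure Ω} [IsProbabilityMeasure μ] {s : ℕ → Set Ω}
    {t : Set Ω} (ht : MeasurableSet t) (hts : ∀ n, t ⊆ s n)
    (htend : Tendsto (fun n => μ (s n)) atTop (𝓝 (μ t))) (hpos : 0 < μ t)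
    {g : ℕ → Ω → ℝ} (hg : ∀ n, Measurable (g n)) {B : ℝ} (hB : ∀ n ω, ‖g n ω‖ ≤ B) :
    Tendsto (fun n => ∫ ω, g n ω ∂(ProbabilityTheory.cond μ (s n))
      - ∫ ω, g n ω ∂(ProbabilityTheory.cond μ t)) atTop (𝓝 0) := by
  have ht0 : 0 < μ.real t := ENNReal.toReal_pos hpos.ne' (measure_ne_top _ _)
  have hreal : Tendsto (fun n => μ.real (s n)) atTop (𝓝 (μ.real t)) :=
    (ENNReal.tendsto_toReal (measure_ne_top μ t)).comp htend
  have hgi : ∀ n, Integrable (g n) μ := fun n =>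
    Integrable.of_bound (hg n).aestronglyMeasurable B (Eventually.of_forall (hB n))
  have hle : ∀ n (r : Set Ω), ‖∫ ω in r, g n ω ∂μ‖ ≤ B * μ.real r := fun n r =>
    norm_setIntegral_le_of_norm_le_const (measure_lt_top _ _) fun ω _ => hB n ω
  have hdiff : ∀ n, ‖∫ ω in s n, g n ω ∂μ - ∫ ω in t, g n ω ∂μ‖
      ≤ B * (μ.real (s n) - μ.real t) := fun n => by
    rw [← setIntegral_sdiff ht (hgi n).integrableOn (hts n),
      ← measureReal_sdiff (hts n) ht]
    exact hle n _
  have h1 : Tendsto (fun n => ∫ ω in s n, g n ω ∂μ - ∫ ω in t, g n ω ∂μ) atTop (𝓝 0) := by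
    refine squeeze_zero_norm hdiff ?_
    simpa using (hreal.sub_const (μ.real t)).const_mul B
  have h2 : Tendsto (fun n => ((μ.real (s n))⁻¹ - (μ.real t)⁻¹) * ∫ ω in s n, g n ω ∂μ)
      atTop (𝓝 0) := by
    have h3 : Tendsto (fun n => ‖(μ.real (s n))⁻¹ - (μ.real t)⁻¹‖ * B) atTop (𝓝 0) := by
      have := ((hreal.inv₀ ht0.ne').sub_const (μ.real t)⁻¹).norm.mul_const B
      simpa using this
    refine squeeze_zero_norm (fun n => ?_) h3
    rw [norm_mul]
    have hB0 : 0 ≤ B * μ.real (s n) := (norm_nonneg _).trans (hle n (s n))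
    have hB1 : B * μ.real (s n) ≤ B := by
      have hp : 0 < μ.real (s n) := ht0.trans_le (measureReal_mono (hts n))
      exact mul_le_of_le_one_right (nonneg_of_mul_nonneg_left hB0 hp) measureReal_le_one
    exact mul_le_mul_of_nonneg_left ((hle n _).trans hB1) (norm_nonneg _)
  -- With I_s, I_t the integrals over s n and t: I_s/μ(s) − I_t/μ(t) = (1/μ(s) − 1/μ(t)) I_s + (I_s
  -- − I_t)/μ(t).
  have h3 := h2.add (h1.const_mul (μ.real t)⁻¹)
  rw [mul_zero, add_zero] at h3
  refine h3.congr fun n => ?_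
  rw [integral_cond, integral_cond]
  ring

/-- The test functions are bounded, so the two conditional expectations differ by o(1). -/
lemma tendstoGaussianGiven_nonExtinctUpTo_iff [IsProbabilityMeasure μ]
    (hX : ∀ n, Measurable (X n)) (hpos : 0 < μ (U.nonExtinct X))
    {Y : ℕ → Ω → EuclideanSpace ℝ (Fin q)} (hY : ∀ n, Measurable (Y n))
    {S : Matrix (Fin q) (Fin q) ℝ} :
    TendstoGaussianGiven μ (U.nonExtinctUpTo X) Y S
      ↔ TendstoGaussianGiven μ (fun _ => U.nonExtinct X) Y S := by
  refine forall_congr' fun f => ?_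
  have h := tendsto_integral_cond_sub (μ := μ)
    (measurableSet_nonExtinct hX) nonExtinct_subset_nonExtinctUpTo (tendsto_measure_nonExtinctUpTo hX) hpos
    (g := fun n ω => f (Y n ω)) (fun n => f.continuous.measurable.comp (hY n))
    (fun n ω => f.norm_coe_le_norm (Y n ω))
  constructor
  · intro h1
    have := h1.sub h
    simpa using this
  · intro h1
    have := h1.add h
    simpa using this

/-- Weak convergence is not affected by a shift that tends to zero. -/
lemma TendstoGaussianGiven.sub_const [IsProbabilityMeasure μ] {C : ℕ → Set Ω}
    (hC : ∀ n, μ (C n) ≠ 0) {Y : ℕ → Ω → EuclideanSpace ℝ (Fin q)} (hY : ∀ n, Measurable (Y n))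
    {S : Matrix (Fin q) (Fin q) ℝ} (h : TendstoGaussianGiven μ C Y S)
    {d : ℕ → EuclideanSpace ℝ (Fin q)} (hd : Tendsto d atTop (𝓝 0)) :
    TendstoGaussianGiven μ C (fun n ω => Y n ω - d n) S := by
  have hP : ∀ n, IsProbabilityMeasure (ProbabilityTheory.cond μ (C n)) := fun n =>
    ProbabilityTheory.cond_isProbabilityMeasure (hC n)
  have hY' : ∀ n, Measurable fun ω => Y n ω - d n := fun n => (hY n).sub_const _
  let ν : ProbabilityMeasure (EuclideanSpace ℝ (Fin q)) := ⟨multivariateGaussian 0 S, inferInstance⟩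
  let law : (Z : ℕ → Ω → EuclideanSpace ℝ (Fin q)) → (∀ n, Measurable (Z n)) → ℕ →
      ProbabilityMeasure (EuclideanSpace ℝ (Fin q)) := fun Z hZ n =>
    ⟨(ProbabilityTheory.cond μ (C n)).map (Z n),
      Measure.isProbabilityMeasure_map (hZ n).aemeasurable⟩
  have hlaw : ∀ Z (hZ : ∀ n, Measurable (Z n)) n (f : EuclideanSpace ℝ (Fin q) → ℝ),
      Continuous f → ∫ y, f y ∂(law Z hZ n : Measure _)
        = ∫ ω, f (Z n ω) ∂(ProbabilityTheory.cond μ (C n)) := fun Z hZ n f hf =>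
    integral_map (hZ n).aemeasurable hf.aestronglyMeasurable
  have h1 : Tendsto (law Y hY) atTop (𝓝 ν) := by
    rw [ProbabilityMeasure.tendsto_iff_forall_integral_tendsto]
    intro f
    simp_rw [hlaw Y hY _ f f.continuous]
    exact h f
  suffices h2 : Tendsto (law _ hY') atTop (𝓝 ν) by
    intro f
    rw [ProbabilityMeasure.tendsto_iff_forall_integral_tendsto] at h2
    have := h2 f
    simp_rw [hlaw _ hY' _ f f.continuous] at this
    exact this
  -- For a bounded L-Lipschitz test function the shift changes the integral by at most L‖d n‖.
  rw [tendsto_iff_forall_lipschitz_integral_tendsto] at h1 ⊢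
  intro f hfb hfl
  have h3 := h1 f hfb hfl
  obtain ⟨L, hL⟩ := hfl
  obtain ⟨B, hB⟩ := hfb
  simp_rw [hlaw _ hY' _ f hL.continuous]
  simp_rw [hlaw _ hY _ f hL.continuous] at h3
  have hint : ∀ n (Z : Ω → EuclideanSpace ℝ (Fin q)), Measurable Z →
      Integrable (fun ω => f (Z ω)) (ProbabilityTheory.cond μ (C n)) := by
    intro n Z hZ
    -- B bounds the oscillation of f rather than f itself, hence the extra ‖f 0‖.
    refine Integrable.of_bound (C := B + ‖f 0‖)
      (hL.continuous.measurable.comp hZ).aestronglyMeasurable (Eventually.of_forall fun ω => ?_)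
    have h4 := hB (Z ω) 0
    rw [dist_eq_norm] at h4
    have := norm_add_le (f (Z ω) - f 0) (f 0)
    rw [sub_add_cancel] at this
    linarith
  have h4 : Tendsto (fun n => ∫ ω, f (Y n ω - d n) ∂(ProbabilityTheory.cond μ (C n))
      - ∫ ω, f (Y n ω) ∂(ProbabilityTheory.cond μ (C n))) atTop (𝓝 0) := by
    have h5 : Tendsto (fun n => (L : ℝ) * ‖d n‖) atTop (𝓝 0) := by
      simpa using hd.norm.const_mul (L : ℝ)
    refine squeeze_zero_norm (fun n => ?_) h5
    rw [← integral_sub (hint n _ (hY' n)) (hint n _ (hY n))]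
    refine (norm_integral_le_of_norm_le_const (C := L * ‖d n‖)
      (Eventually.of_forall fun ω => ?_)).trans (by simp)
    rw [← dist_eq_norm]
    refine (hL.dist_le_mul _ _).trans_eq ?_
    rw [dist_eq_norm]; simp
  simpa using h4.add h3

/-- Only |t| > R contributes, and there (|t| − R)R ≤ t². A second-moment bound thus gives a uniform
O(1/R) truncation error. -/
lemma abs_clamp_sub_le {R : ℝ} (hR : 0 < R) (t : ℝ) :
    |max (-R) (min t R) - t| ≤ t ^ 2 / R := by
  rw [le_div_iff₀ hR]
  rcases le_total t R with h | h
  · rw [min_eq_left h]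
    rcases le_total (-R) t with h' | h'
    · rw [max_eq_right h', sub_self, abs_zero, zero_mul]; positivity
    · rw [max_eq_left h', abs_of_nonneg (by linarith)]
      nlinarith
  · rw [min_eq_right h, max_eq_right (by linarith), abs_of_nonpos (by linarith)]
    nlinarith

lemma abs_integral_clamp_sub_le {α : Type*} [MeasurableSpace α] {P : Measure α}
    [IsProbabilityMeasure P] {R : ℝ} (hR : 0 < R) {g : α → ℝ} (hg : MemLp g 2 P) :
    |∫ x, max (-R) (min (g x) R) ∂P - ∫ x, g x ∂P| ≤ (∫ x, g x ^ 2 ∂P) / R := by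
  have hc : Integrable (fun x => max (-R) (min (g x) R)) P := by
    refine Integrable.of_bound (C := R) ?_ (Eventually.of_forall fun x => ?_)
    · exact (by fun_prop : Continuous fun t : ℝ => max (-R) (min t R)).comp_aestronglyMeasurable
        hg.aestronglyMeasurable
    · rw [Real.norm_eq_abs, abs_le]
      exact ⟨le_max_left _ _, max_le (by linarith) (min_le_right _ _)⟩
  rw [← integral_sub hc (hg.integrable one_le_two), ← integral_div]
  refine (abs_integral_le_integral_abs).trans (integral_mono_of_nonneg
    (Eventually.of_forall fun x => abs_nonneg _) (hg.integrable_sq.div_const R)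
    (Eventually.of_forall fun x => abs_clamp_sub_le hR (g x)))

/-- Weak convergence with bounded second moments implies convergence of the means. -/
lemma tendsto_integral_of_tendsto_of_sq_le {E : Type*} [TopologicalSpace E] [MeasurableSpace E]
    {P : ℕ → Measure Ω} [∀ n, IsProbabilityMeasure (P n)] {ν : Measure E}
    [IsProbabilityMeasure ν] {Y : ℕ → Ω → E} {g : E → ℝ} (hg : Continuous g)
    (hY : ∀ n, MemLp (fun ω => g (Y n ω)) 2 (P n)) (hν : MemLp g 2 ν) {K : ℝ}
    (hK : ∀ n, ∫ ω, g (Y n ω) ^ 2 ∂(P n) ≤ K)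
    (h : ∀ f : E →ᵇ ℝ, Tendsto (fun n => ∫ ω, f (Y n ω) ∂(P n)) atTop (𝓝 (∫ y, f y ∂ν))) :
    Tendsto (fun n => ∫ ω, g (Y n ω) ∂(P n)) atTop (𝓝 (∫ y, g y ∂ν)) := by
  rw [Metric.tendsto_atTop]
  intro ε hε
  set M := max K (∫ y, g y ^ 2 ∂ν)
  have hM : 0 ≤ M := (integral_nonneg fun y => sq_nonneg (g y)).trans (le_max_right _ _)
  -- Both truncation errors fall below ε/3, leaving ε/3 for weak convergence tested on the truncated
  -- function.
  set R := 3 * (M + 1) / ε with hR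
  have hR0 : 0 < R := by positivity
  have hMR : M / R < ε / 3 := by
    rw [div_lt_iff₀ hR0, hR]; field_simp; linarith
  let f : E →ᵇ ℝ := BoundedContinuousFunction.ofNormedAddCommGroup
    (fun y => max (-R) (min (g y) R)) (by fun_prop) R fun y => by
      rw [Real.norm_eq_abs, abs_le]
      exact ⟨le_max_left _ _, max_le (by linarith) (min_le_right _ _)⟩
  obtain ⟨N, hN⟩ := Metric.tendsto_atTop.1 (h f) (ε / 3) (by positivity)
  refine ⟨N, fun n hn => ?_⟩
  have h1 := hN n hn
  have h2 := abs_integral_clamp_sub_le hR0 (hY n)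
  have h3 := abs_integral_clamp_sub_le hR0 hν
  have h4 : (∫ ω, g (Y n ω) ^ 2 ∂(P n)) / R ≤ M / R := by
    gcongr; exact (hK n).trans (le_max_left _ _)
  have h5 : (∫ y, g y ^ 2 ∂ν) / R ≤ M / R := by
    gcongr; exact le_max_right _ _
  rw [Real.dist_eq] at h1 ⊢
  change |∫ ω, max (-R) (min (g (Y n ω)) R) ∂(P n) - ∫ y, max (-R) (min (g y) R) ∂ν| < ε / 3 at h1
  rw [abs_lt] at h1 ⊢
  rw [abs_le] at h2 h3
  constructor <;> linarith

end PolyaUrn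

/-! ### Convergence of the normalised conditional means, and the theorem. -/

namespace PolyaUrn

variable {q : ℕ} {U : PolyaUrn q}
variable {Ω : Type*} [MeasurableSpace Ω] {μ : Measure Ω} {X : ℕ → Ω → EuclideanSpace ℝ (Fin q)}

lemma memLp_two_cond_nonExtinctUpTo [IsProbabilityMeasure μ] (hX : U.IsUrnEvolution μ X)
    (hT : Tenable μ X) (h2 : ∀ i, MemLp id 2 (U.replacement i)) {n : ℕ}
    (hpos : μ (U.nonExtinctUpTo X n) ≠ 0) :
    MemLp (X n) 2 (ProbabilityTheory.cond μ (U.nonExtinctUpTo X n)) :=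
  (memLp_composition hX hT h2 n).smul_measure (ENNReal.inv_ne_top.2 hpos)

/-- The conditional means of the normalized composition tend to zero. -/
lemma tendsto_integral_normalized [IsProbabilityMeasure μ] {b : ℝ}
    (hX : U.IsUrnEvolution μ X) (hU : U.AssumptionU μ X b 2) (hsmall : U.StrictlySmall b)
    {v : EuclideanSpace ℝ (Fin q)} (hv : U.intensity *ᵥ v.ofLp = b • v.ofLp)
    (hav : ∑ i, U.activity i * v i = 1) {S : Matrix (Fin q) (Fin q) ℝ}
    (hCLT : NormalLimit μ X (U.nonExtinctUpTo X) (fun n => ((n : ℝ) * b) • v) S) :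
    Tendsto (fun n : ℕ => ∫ ω, (Real.sqrt n)⁻¹ • (X n ω - ((n : ℝ) * b) • v)
      ∂(ProbabilityTheory.cond μ (U.nonExtinctUpTo X n))) atTop (𝓝 0) := by
  have hpos := measure_nonExtinct_pos hX hU
  have hsub := nonExtinct_subset_nonExtinctUpTo (U := U) (X := X)
  have hEpos : ∀ n, μ (U.nonExtinctUpTo X n) ≠ 0 := fun n =>
    (hpos.trans_le (measure_mono (hsub n))).ne'
  have hP : ∀ n, IsProbabilityMeasure (ProbabilityTheory.cond μ (U.nonExtinctUpTo X n)) :=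
    fun n => ProbabilityTheory.cond_isProbabilityMeasure (hEpos n)
  set e := μ.real (U.nonExtinct X)
  have he : 0 < e := ENNReal.toReal_pos hpos.ne' (measure_ne_top _ _)
  set Y : ℕ → Ω → EuclideanSpace ℝ (Fin q) := fun n ω =>
    (Real.sqrt n)⁻¹ • (X n ω - ((n : ℝ) * b) • v) with hYdef
  have hY2 : ∀ n, MemLp (Y n) 2 (ProbabilityTheory.cond μ (U.nonExtinctUpTo X n)) := fun n =>
    ((memLp_two_cond_nonExtinctUpTo hX hU.tenable hU.moment (hEpos n)).sub
      (memLp_const (((n : ℝ) * b) • v))).const_smul (Real.sqrt n)⁻¹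
  obtain ⟨K, hK⟩ := exists_integral_norm_sub_sq_le hX hU hsmall hv hav
  have hK0 : 0 ≤ K := by
    have := (integral_nonneg fun ω => by positivity).trans (hK 0)
    simpa using this
  have hYK : ∀ n, ∫ ω, ‖Y n ω‖ ^ 2 ∂(ProbabilityTheory.cond μ (U.nonExtinctUpTo X n))
      ≤ e⁻¹ * (2 * K) := by
    intro n
    rw [integral_cond]
    -- At n = 0 the convention 0⁻¹ = 0 makes Y 0 vanish; for n ≥ 1 the factor 2 bounds (n + 1)/n.
    have hle : ∫ ω in U.nonExtinctUpTo X n, ‖Y n ω‖ ^ 2 ∂μ ≤ 2 * K := by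
      rcases Nat.eq_zero_or_pos n with rfl | hn
      · simp [hYdef]; positivity
      · have hn' : (1 : ℝ) ≤ n := by exact_mod_cast hn
        have hn0 : (0 : ℝ) < n := by linarith
        have h1 : ∀ ω, ‖Y n ω‖ ^ 2 = (n : ℝ)⁻¹ * ‖X n ω - ((n : ℝ) * b) • v‖ ^ 2 := fun ω => by
          rw [hYdef]
          simp only [norm_smul, mul_pow, norm_inv, Real.norm_eq_abs, inv_pow, sq_abs]
          rw [Real.sq_sqrt hn0.le]
        simp_rw [h1]
        rw [integral_const_mul, inv_mul_le_iff₀ hn0]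
        have := hK n
        nlinarith
    have hinv : (μ.real (U.nonExtinctUpTo X n))⁻¹ ≤ e⁻¹ :=
      inv_anti₀ he (measureReal_mono (hsub n))
    exact mul_le_mul hinv hle (integral_nonneg fun ω => by positivity) (by positivity)
  have hgauss : MemLp (id : EuclideanSpace ℝ (Fin q) → _) 2 (multivariateGaussian 0 S) :=
    IsGaussian.memLp_two_id
  have hcoord : ∀ i : Fin q, Tendsto (fun n => (∫ ω, Y n ω
      ∂(ProbabilityTheory.cond μ (U.nonExtinctUpTo X n))) i) atTop (𝓝 0) := by
    intro i
    have hval : ∫ y : EuclideanSpace ℝ (Fin q), y i ∂(multivariateGaussian 0 S) = 0 := by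
      have h := (EuclideanSpace.proj (𝕜 := ℝ) i).integral_comp_comm
        (hgauss.integrable one_le_two)
      simpa [integral_id_multivariateGaussian'] using h
    have h := tendsto_integral_of_tendsto_of_sq_le (P := fun n =>
      ProbabilityTheory.cond μ (U.nonExtinctUpTo X n)) (ν := multivariateGaussian 0 S) (Y := Y)
      (g := fun y => y i) (K := e⁻¹ * (2 * K)) (by fun_prop)
      (fun n => (EuclideanSpace.proj (𝕜 := ℝ) i).comp_memLp' (hY2 n))
      ((EuclideanSpace.proj (𝕜 := ℝ) i).comp_memLp' hgauss)
      (fun n => (integral_mono_of_nonneg (Eventually.of_forall fun ω => sq_nonneg _)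
        ((hY2 n).integrable_norm_pow (by norm_num)) (Eventually.of_forall fun ω => ?_)).trans
          (hYK n)) hCLT
    · rw [hval] at h
      refine h.congr fun n => ?_
      exact (EuclideanSpace.proj (𝕜 := ℝ) i).integral_comp_comm ((hY2 n).integrable one_le_two)
    · have := PiLp.norm_apply_le (Y n ω) i
      rw [Real.norm_eq_abs] at this
      exact sq_le_sq' (by linarith [neg_abs_le (Y n ω i)]) ((le_abs_self _).trans this)
  have hpi := tendsto_pi_nhds.2 hcoord
  exact ((PiLp.continuous_toLp 2 (fun _ : Fin q => ℝ)).tendsto 0).comp hpi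

end PolyaUrn

theorem mainTheorem4 {q : ℕ} (hq : 2 ≤ q) (U : PolyaUrn q) (b : ℝ)
    {Ω : Type*} [MeasurableSpace Ω] (μ : Measure Ω) [IsProbabilityMeasure μ]
    (X : ℕ → Ω → EuclideanSpace ℝ (Fin q)) (hX : U.IsUrnEvolution μ X)
    (hU : U.AssumptionU μ X b 2) (hsmall : U.StrictlySmall b)
    (v₁ : EuclideanSpace ℝ (Fin q))
    (hv₁ : U.intensity *ᵥ v₁.ofLp = b • v₁.ofLp) (hav₁ : ∑ i, U.activity i * v₁ i = 1)
    (S : Matrix (Fin q) (Fin q) ℝ) (hS : S.PosSemidef)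
    (hCLT : PolyaUrn.NormalLimit μ X (U.nonExtinctUpTo X) (fun n => ((n : ℝ) * b) • v₁) S ∨
      PolyaUrn.NormalLimit μ X (fun _ => U.nonExtinct X) (fun n => ((n : ℝ) * b) • v₁) S) :
    (0 < μ (U.nonExtinct X) ∧
      ∀ n, Integrable (X n) (ProbabilityTheory.cond μ (U.nonExtinctUpTo X n))) ∧
    ((fun n : ℕ => U.condMean μ X n - ((n : ℝ) * b) • v₁) =o[atTop]
      fun n : ℕ => Real.sqrt n) ∧
    PolyaUrn.NormalLimit μ X (U.nonExtinctUpTo X) (U.condMean μ X) S ∧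
    PolyaUrn.NormalLimit μ X (fun _ => U.nonExtinct X) (U.condMean μ X) S := by
  have hpos := PolyaUrn.measure_nonExtinct_pos hX hU
  have hEpos : ∀ n, μ (U.nonExtinctUpTo X n) ≠ 0 := fun n =>
    (hpos.trans_le (measure_mono (PolyaUrn.nonExtinct_subset_nonExtinctUpTo n))).ne'
  have hint : ∀ n, Integrable (X n) (ProbabilityTheory.cond μ (U.nonExtinctUpTo X n)) := fun n =>
    have := ProbabilityTheory.cond_isProbabilityMeasure (hEpos n)
    (PolyaUrn.memLp_two_cond_nonExtinctUpTo hX hU.tenable hU.moment (hEpos n)).integrable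
      one_le_two
  have hYm : ∀ c : ℕ → EuclideanSpace ℝ (Fin q), ∀ n : ℕ,
      Measurable fun ω => (Real.sqrt n)⁻¹ • (X n ω - c n) := fun c n =>
    ((hX.measurable n).sub_const (c n)).const_smul (Real.sqrt n)⁻¹
  have hiff : ∀ c, PolyaUrn.NormalLimit μ X (U.nonExtinctUpTo X) c S
      ↔ PolyaUrn.NormalLimit μ X (fun _ => U.nonExtinct X) c S := fun c =>
    PolyaUrn.tendstoGaussianGiven_nonExtinctUpTo_iff hX.measurable hpos (hYm c)
  have hCLT' : PolyaUrn.NormalLimit μ X (U.nonExtinctUpTo X) (fun n => ((n : ℝ) * b) • v₁) S :=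
    hCLT.elim id (hiff _).2
  have hmean := PolyaUrn.tendsto_integral_normalized hX hU hsmall hv₁ hav₁ hCLT'
  have hd : ∀ n : ℕ, ∫ ω, (Real.sqrt n)⁻¹ • (X n ω - ((n : ℝ) * b) • v₁)
      ∂(ProbabilityTheory.cond μ (U.nonExtinctUpTo X n))
      = (Real.sqrt n)⁻¹ • (U.condMean μ X n - ((n : ℝ) * b) • v₁) := fun n => by
    have := ProbabilityTheory.cond_isProbabilityMeasure (hEpos n)
    rw [integral_smul, integral_sub (hint n) (integrable_const _), integral_const,
      probReal_univ, one_smul]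
    rfl
  simp_rw [hd] at hmean
  -- The normalised difference of the two centres is deterministic and tends to zero by `hmean`, so
  -- subtracting it exchanges the centres.
  have hlim : PolyaUrn.NormalLimit μ X (U.nonExtinctUpTo X) (U.condMean μ X) S := by
    have h := PolyaUrn.TendstoGaussianGiven.sub_const hEpos (hYm _) hCLT' hmean
    have e : (fun (n : ℕ) ω => (Real.sqrt n)⁻¹ • (X n ω - ((n : ℝ) * b) • v₁)
        - (Real.sqrt n)⁻¹ • (U.condMean μ X n - ((n : ℝ) * b) • v₁))
        = fun (n : ℕ) ω => (Real.sqrt n)⁻¹ • (X n ω - U.condMean μ X n) := by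
      funext n ω
      rw [← smul_sub, sub_sub_sub_cancel_right]
    rw [e] at h
    exact h
  -- `hiff` allows any centring, so the mean given E_n remains the centre when conditioning on
  -- survival.
  refine ⟨⟨hpos, hint⟩, ?_, hlim, (hiff _).1 hlim⟩
  rw [← isLittleO_norm_left, isLittleO_iff_tendsto']
  · have h := hmean.norm
    rw [norm_zero] at h
    refine h.congr fun n => ?_
    rw [norm_smul, norm_inv, Real.norm_of_nonneg (Real.sqrt_nonneg _), div_eq_inv_mul]
  -- √n vanishes at n = 0, so the quotient criterion applies only from n = 1 on.
  · filter_upwards [eventually_ge_atTop 1] with n hn h0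
    have : 0 < Real.sqrt n := Real.sqrt_pos.2 (by exact_mod_cast hn)
    exact absurd h0 this.ne'
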